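/- For $k\in\mathbb N_0$ let $H_k(t)=(-1)^k e^{t^2}\frac{d^k}{dt^k}e^{-t^2}$ be the Hermite polynomials and let $$\varphi_k(t)=\big(2^k k!\sqrt{\pi}\big)^{-1/2}H_k(t)e^{-t^2/2}\qquad(t\in\mathbb R)$$ be the Hermite functions. For $n\in\mathbb N=\{1,2,3,\dots\}$ and $x,y\in\mathbb R$ let $$\rho_n(x,y)=\frac n4\Big[\varphi_n\big(\sqrt{\tfrac n2}\,x\big)\varphi_{n-1}\big(\sqrt{\tfrac n2}\,y\big)-\varphi_{n-1}\big(\sqrt{\tfrac n2}\,x\big)\varphi_n\big(\sqrt{\tfrac n2}\,y\big)\Big]^2 .$$ Let $C_b^\infty(\mathbb R^2)$ be the space of infinitely often differentiable functions $f\colon\mathbb R^2\to\mathbb C$ such that $\sup_{(x,y)\in\mathbb R^2}|D_1^kD_2^lf(x,y)|<\infty$ for all $k,l\in\mathbb N_0$, where $D_1,D_2$ denote the partial derivatives with respect to the first and the second variable. **Theorem.** Let $f\in C_b^\infty(\mathbb R^2)$. Then $f\rho_n$ is Lebesgue integrable on $\mathbb R^2$ for every $n\in\mathbb N$, and there exists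 a sequence $(\beta_j(f))_{j\in\mathbb N_0}$ of complex numbers, independent of $n$ and $k$, such that for every $k\in\mathbb N_0$ $$\int_{\mathbb R^2}f(x,y)\rho_n(x,y)\,dx\,dy=\sum_{j=0}^k\frac{\beta_j(f)}{n^{2j}}+O\big(n^{-2k-2}\big),$$ that is, there is a constant $C=C(f,k)$ such that for all $n\in\mathbb N$ the difference between the integral and the sum has absolute value at most $C\,n^{-2k-2}$. -/

import Mathlib

open scoped ContDiff

noncomputable section

namespace GUEExpansion

/-- The (physicists') Hermite polynomial
`H_k(t) = (-1)^k exp(t^2) (d^k/dt^k) exp(-t^2)`, as a function on the real line. -/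
def hermiteH (k : ℕ) (t : ℝ) : ℝ :=
  (-1) ^ k * Real.exp (t ^ 2) * iteratedDeriv k (fun s : ℝ => Real.exp (-s ^ 2)) t

/-- The Hermite function
`φ_k(t) = (2^k k! √π)^(-1/2) H_k(t) exp(-t^2/2)`. -/
def hermiteFun (k : ℕ) (t : ℝ) : ℝ :=
  (Real.sqrt (2 ^ k * (Nat.factorial k : ℝ) * Real.sqrt Real.pi))⁻¹ *
    hermiteH k t * Real.exp (-t ^ 2 / 2)

/-- The kernel `ρ_n(x,y)`; it is meant for `n ≥ 1`, where `n - 1` is the true predecessor. -/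
def rho (n : ℕ) (x y : ℝ) : ℝ :=
  (n : ℝ) / 4 *
    (hermiteFun n (Real.sqrt ((n : ℝ) / 2) * x) * hermiteFun (n - 1) (Real.sqrt ((n : ℝ) / 2) * y)
      - hermiteFun (n - 1) (Real.sqrt ((n : ℝ) / 2) * x) *
        hermiteFun n (Real.sqrt ((n : ℝ) / 2) * y)) ^ 2

/-- Partial derivative with respect to the first variable. -/
def D₁ (f : ℝ × ℝ → ℂ) : ℝ × ℝ → ℂ := fun p => deriv (fun s : ℝ => f (s, p.2)) p.1

/-- Partial derivative with respect to the second variable. -/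
def D₂ (f : ℝ × ℝ → ℂ) : ℝ × ℝ → ℂ := fun p => deriv (fun t : ℝ => f (p.1, t)) p.2

/-- Membership in `C_b^∞(ℝ²)`: complex-valued smooth functions on the plane all of whose partial
derivatives `D₁^k D₂^l f`, `k, l ≥ 0`, are bounded. -/
structure IsCbInfty (f : ℝ × ℝ → ℂ) : Prop where
  smooth : ContDiff ℝ ∞ f
  bounded : ∀ k l : ℕ, ∃ C : ℝ, ∀ p : ℝ × ℝ, ‖(D₁^[k] (D₂^[l] f)) p‖ ≤ C

end GUEExpansion

end

/-! The Hermite recurrences turn S = `densS n`, M = `densM n`, D = `densD n` into a closed linear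
system: S' = -n x D, M' = -n D, D' = n (4M - x S). By `rho_eq`, 4ρ_n(x,y) = S(x)S(y) - D(x)D(y) - 4
M(x)M(y). It therefore suffices to expand one-variable integrals against S, M and nD in powers of ε
= n⁻², uniformly enough to handle two variables.

Integration by parts gives n∫gD = ∫g'M, then ∫xgS - 4∫gM = ε∫g''M, and ∫f'S = ∫(xf)'M. The first
reduces D to M, the second reduces M to S up to a factor ε. For Lf = (4 - x²)f' - xf the last two
combine to ∫(Lf)S = -ε∫(xf)'''M (`integral_arcsineOp_mul_densS`). So if g = c + Lq, then ∫gS = 2c -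
ε∫(xq)'''M, and an expansion of order k for M yields order k+1 for S, hence for M.

The equation g = c + Lq is solved exactly for polynomials, and a general g is approximated by
polynomials together with its derivatives on [-3,3]. The limit is legitimate for two reasons: a
maximum principle bounds c and the derivatives of q by those of g (`exists_bound_of_arcsineOp`,
`abs_const_le_of_arcsineOp`), and expansions with a fixed remainder constant survive uniform limits
(`HasExp.of_uniform_approx`). Since q is uncontrolled off [-3,3], a cutoff is used. Its cost is
O(ε^k) for every k by `exists_tail_bound`, which rests on |M| ≤ S/2.

In two variables, the coefficients of the inner integral are smooth in y with bounded derivatives,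
so they are test functions for the outer integral (`hasExp_iterated_integral`). The D-term is ε
times a product of two factors nD. -/

namespace GUEExpansion

open MeasureTheory Filter Topology Polynomial

/-! ### Hermite functions -/

/-- The physicists' Hermite polynomials as elements of `ℝ[X]`. -/
noncomputable def hermiteP : ℕ → ℝ[X]
  | 0 => 1
  | k + 1 => C 2 * X * hermiteP k - derivative (hermiteP k)

theorem iteratedDeriv_gaussian (k : ℕ) (t : ℝ) :
    iteratedDeriv k (fun s : ℝ => Real.exp (-s ^ 2)) t
      = (-1) ^ k * (hermiteP k).eval t * Real.exp (-t ^ 2) := by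
  induction k generalizing t with
  | zero => simp [hermiteP]
  | succ k ih =>
    rw [iteratedDeriv_succ, funext ih]
    have h1 : HasDerivAt (fun t : ℝ => (hermiteP k).eval t) ((derivative (hermiteP k)).eval t) t :=
      (hermiteP k).hasDerivAt t
    have h2 : HasDerivAt (fun t : ℝ => Real.exp (-t ^ 2))
        (Real.exp (-t ^ 2) * (-(2 * t))) t := by
      have := ((hasDerivAt_pow 2 t).neg).exp
      simpa using this
    have h3 := ((h1.const_mul ((-1) ^ k)).mul h2).deriv
    simp only [Pi.mul_def] at h3
    rw [h3]
    simp [hermiteP]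
    ring

theorem hermiteH_eq (k : ℕ) (t : ℝ) : hermiteH k t = (hermiteP k).eval t := by
  rw [hermiteH, iteratedDeriv_gaussian]
  have h : Real.exp (t ^ 2) * Real.exp (-t ^ 2) = 1 := by rw [← Real.exp_add]; simp
  have h' : ((-1 : ℝ) ^ k) * (-1) ^ k = 1 := by rw [← mul_pow]; simp
  linear_combination ((-1 : ℝ) ^ k * (-1) ^ k * (hermiteP k).eval t) * h + (hermiteP k).eval t * h'

theorem derivative_hermiteP_succ (k : ℕ) :
    derivative (hermiteP (k + 1)) = C (2 * (k + 1 : ℝ)) * hermiteP k := by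
  induction k with
  | zero => simp [hermiteP]
  | succ k ih =>
    rw [hermiteP, derivative_sub, ih, derivative_mul, derivative_C_mul, ih]
    simp only [derivative_C, derivative_X, derivative_mul]
    rw [show hermiteP (k + 1) = C 2 * X * hermiteP k - derivative (hermiteP k) from rfl]
    simp only [map_mul, map_add, map_natCast, map_one, Nat.cast_add, Nat.cast_one]
    ring

/-- The normalization constant of the Hermite functions. -/
noncomputable def hermiteNorm (k : ℕ) : ℝ :=
  (Real.sqrt (2 ^ k * (Nat.factorial k : ℝ) * Real.sqrt Real.pi))⁻¹

theorem hermiteFun_eq (k : ℕ) (t : ℝ) :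
    hermiteFun k t = hermiteNorm k * (hermiteP k).eval t * Real.exp (-t ^ 2 / 2) := by
  rw [hermiteFun, hermiteH_eq, hermiteNorm]

theorem hermiteNorm_succ (k : ℕ) :
    Real.sqrt (2 * (k + 1 : ℝ)) * hermiteNorm (k + 1) = hermiteNorm k := by
  have h : (2 : ℝ) ^ (k + 1) * ((k + 1).factorial : ℝ) * Real.sqrt Real.pi
      = (2 * (k + 1 : ℝ)) * (2 ^ k * (k.factorial : ℝ) * Real.sqrt Real.pi) := by
    rw [Nat.factorial_succ]; push_cast; ring
  have hp : 0 < Real.sqrt (2 * (k + 1 : ℝ)) := Real.sqrt_pos.2 (by positivity)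
  rw [hermiteNorm, hermiteNorm, h, Real.sqrt_mul (x := 2 * (k + 1 : ℝ)) (by positivity), mul_inv,
    ← mul_assoc,
    mul_inv_cancel₀ hp.ne', one_mul]

theorem hasDerivAt_exp_neg_sq_half (t : ℝ) :
    HasDerivAt (fun t : ℝ => Real.exp (-t ^ 2 / 2)) (Real.exp (-t ^ 2 / 2) * (-t)) t := by
  have h : HasDerivAt (fun t : ℝ => -t ^ 2 / 2) (-t) t := by
    refine (((hasDerivAt_pow 2 t).neg).div_const 2).congr_deriv ?_
    push_cast
    ring
  exact h.exp

theorem hasDerivAt_hermiteFun_succ (k : ℕ) (t : ℝ) :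
    HasDerivAt (hermiteFun (k + 1))
      (-t * hermiteFun (k + 1) t + Real.sqrt (2 * (k + 1 : ℝ)) * hermiteFun k t) t := by
  rw [funext (hermiteFun_eq (k + 1)), hermiteFun_eq k, ← hermiteNorm_succ k]
  have h := (((hermiteP (k + 1)).hasDerivAt t).const_mul (hermiteNorm (k + 1))).mul
    (hasDerivAt_exp_neg_sq_half t)
  have hs : Real.sqrt (2 * (k + 1 : ℝ)) * Real.sqrt (2 * (k + 1 : ℝ)) = 2 * (k + 1) :=
    Real.mul_self_sqrt (by positivity)
  refine h.congr_deriv ?_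
  rw [derivative_hermiteP_succ]
  simp only [eval_mul, eval_C]
  linear_combination -(hermiteNorm (k + 1) * (hermiteP k).eval t * Real.exp (-t ^ 2 / 2)) * hs

theorem hasDerivAt_hermiteFun (k : ℕ) (t : ℝ) :
    HasDerivAt (hermiteFun k)
      (t * hermiteFun k t - Real.sqrt (2 * (k + 1 : ℝ)) * hermiteFun (k + 1) t) t := by
  have h := (((hermiteP k).hasDerivAt t).const_mul (hermiteNorm k)).mul
    (hasDerivAt_exp_neg_sq_half t)
  rw [funext (hermiteFun_eq k), hermiteFun_eq (k + 1)]
  refine h.congr_deriv ?_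
  have e : (hermiteP (k + 1)).eval t
      = 2 * t * (hermiteP k).eval t - (derivative (hermiteP k)).eval t := by simp [hermiteP]
  rw [e]
  linear_combination (((2 * t * (hermiteP k).eval t - (derivative (hermiteP k)).eval t) *
    Real.exp (-t ^ 2 / 2))) * hermiteNorm_succ k

/-! ### Polynomials times Gaussians -/

/-- Functions of the form `P(x) exp(-b x²)` with `P` a polynomial and `b > 0`. -/
def IsPolyGauss (u : ℝ → ℝ) : Prop :=
  ∃ (P : ℝ[X]) (b : ℝ), 0 < b ∧ ∀ x, u x = P.eval x * Real.exp (-b * x ^ 2)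

theorem integrable_polynomial_mul_gaussian (P : ℝ[X]) {b : ℝ} (hb : 0 < b) :
    Integrable (fun x : ℝ => P.eval x * Real.exp (-b * x ^ 2)) := by
  induction P using Polynomial.induction_on' with
  | add p q hp hq =>
    simp only [eval_add, add_mul]
    exact hp.add hq
  | monomial n a =>
    have h := integrable_rpow_mul_exp_neg_mul_sq hb (s := (n : ℝ))
      (by have : (0 : ℝ) ≤ n := n.cast_nonneg; linarith)
    simp only [Real.rpow_natCast] at h
    simpa only [eval_monomial, mul_assoc] using h.const_mul a

namespace IsPolyGauss

variable {u v : ℝ → ℝ}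

theorem integrable (hu : IsPolyGauss u) : Integrable u := by
  obtain ⟨P, b, hb, h⟩ := hu
  rw [funext h]
  exact integrable_polynomial_mul_gaussian P hb

theorem continuous (hu : IsPolyGauss u) : Continuous u := by
  obtain ⟨P, b, hb, h⟩ := hu
  rw [funext h]
  fun_prop

theorem mul (hu : IsPolyGauss u) (hv : IsPolyGauss v) : IsPolyGauss (fun x => u x * v x) := by
  obtain ⟨P, b, hb, h⟩ := hu
  obtain ⟨Q, c, hc, h'⟩ := hv
  refine ⟨P * Q, b + c, add_pos hb hc, fun x => ?_⟩
  simp only [h, h']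
  rw [eval_mul, show -(b + c) * x ^ 2 = -b * x ^ 2 + -c * x ^ 2 by ring, Real.exp_add]
  ring

theorem polynomial_mul (P : ℝ[X]) (hu : IsPolyGauss u) : IsPolyGauss (fun x => P.eval x * u x) := by
  obtain ⟨Q, b, hb, h⟩ := hu
  exact ⟨P * Q, b, hb, fun x => by simp only [h, eval_mul]; ring⟩

theorem comp_mul (hu : IsPolyGauss u) {c : ℝ} (hc : c ≠ 0) : IsPolyGauss (fun x => u (c * x)) := by
  obtain ⟨P, b, hb, h⟩ := hu
  refine ⟨P.comp (C c * X), b * c ^ 2, by positivity, fun x => ?_⟩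
  simp only [h, eval_comp, eval_mul, eval_C, eval_X]
  ring_nf

end IsPolyGauss

theorem isPolyGauss_hermiteFun (k : ℕ) : IsPolyGauss (hermiteFun k) :=
  ⟨C (hermiteNorm k) * hermiteP k, 1 / 2, by norm_num, fun x => by
    rw [hermiteFun_eq, eval_mul, eval_C]; ring_nf⟩

/-- The derivative of φ_{k+1}φ_k is √(2(k+1)) (φ_k² - φ_{k+1}²) and integrates to 0, so all the
norms equal that of the Gaussian φ_0. -/
theorem integral_hermiteFun_sq (k : ℕ) : ∫ t, hermiteFun k t ^ 2 = 1 := by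
  induction k with
  | zero =>
    have h : ∀ t, hermiteFun 0 t ^ 2 = (Real.sqrt Real.pi)⁻¹ * Real.exp (-1 * t ^ 2) := by
      intro t
      rw [hermiteFun_eq, hermiteNorm]
      have : Real.exp (-t ^ 2 / 2) ^ 2 = Real.exp (-1 * t ^ 2) := by
        rw [← Real.exp_nat_mul]; congr 1; push_cast; ring
      simp only [hermiteP, eval_one, pow_zero, Nat.factorial_zero, Nat.cast_one, one_mul, mul_one,
        mul_pow, this, inv_pow, Real.sq_sqrt (Real.sqrt_nonneg _)]
    simp_rw [h]
    rw [integral_const_mul, integral_gaussian, div_one]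
    exact inv_mul_cancel₀ (Real.sqrt_pos.2 Real.pi_pos).ne'
  | succ k ih =>
    have i1 := (isPolyGauss_hermiteFun k).mul (isPolyGauss_hermiteFun k)
    have i2 := (isPolyGauss_hermiteFun (k + 1)).mul (isPolyGauss_hermiteFun (k + 1))
    have i3 := (isPolyGauss_hermiteFun (k + 1)).mul (isPolyGauss_hermiteFun k)
    have hd : ∀ t, HasDerivAt (fun t => hermiteFun (k + 1) t * hermiteFun k t)
        (Real.sqrt (2 * (k + 1 : ℝ)) *
          (hermiteFun k t * hermiteFun k t - hermiteFun (k + 1) t * hermiteFun (k + 1) t)) t := by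
      intro t
      refine ((hasDerivAt_hermiteFun_succ k t).mul (hasDerivAt_hermiteFun k t)).congr_deriv ?_
      ring
    have h0 := integral_eq_zero_of_hasDerivAt_of_integrable hd
      ((i1.integrable.sub i2.integrable).const_mul _) i3.integrable
    rw [integral_const_mul, integral_sub i1.integrable i2.integrable] at h0
    have hp : Real.sqrt (2 * (k + 1 : ℝ)) ≠ 0 := (Real.sqrt_pos.2 (by positivity)).ne'
    have := (mul_eq_zero.1 h0).resolve_left hp
    simp only [sq] at ih ⊢
    linarith

/-! ### The densities whose products make up `ρ_n` -/

/-- `√(n/2) (φ_n² + φ_{n-1}²)` at `√(n/2) x`. -/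
noncomputable def densS (n : ℕ) (x : ℝ) : ℝ :=
  Real.sqrt ((n : ℝ) / 2) * (hermiteFun n (Real.sqrt ((n : ℝ) / 2) * x) ^ 2 +
    hermiteFun (n - 1) (Real.sqrt ((n : ℝ) / 2) * x) ^ 2)

/-- `√(n/2) φ_n φ_{n-1}` at `√(n/2) x`. -/
noncomputable def densM (n : ℕ) (x : ℝ) : ℝ :=
  Real.sqrt ((n : ℝ) / 2) * (hermiteFun n (Real.sqrt ((n : ℝ) / 2) * x) *
    hermiteFun (n - 1) (Real.sqrt ((n : ℝ) / 2) * x))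

/-- `√(n/2) (φ_n² - φ_{n-1}²)` at `√(n/2) x`. -/
noncomputable def densD (n : ℕ) (x : ℝ) : ℝ :=
  Real.sqrt ((n : ℝ) / 2) * (hermiteFun n (Real.sqrt ((n : ℝ) / 2) * x) ^ 2 -
    hermiteFun (n - 1) (Real.sqrt ((n : ℝ) / 2) * x) ^ 2)

/-- Expanding (ad - bc)² leaves a²d² + b²c², which is half of (a²+b²)(c²+d²) - (a²-b²)(c²-d²), and
the cross term -2(ab)(cd). -/
theorem rho_eq (n : ℕ) (x y : ℝ) :
    rho n x y = 1 / 4 * (densS n x * densS n y - densD n x * densD n y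
      - 4 * (densM n x * densM n y)) := by
  have h : Real.sqrt ((n : ℝ) / 2) * Real.sqrt ((n : ℝ) / 2) = n / 2 :=
    Real.mul_self_sqrt (by positivity)
  simp only [rho, densS, densD, densM]
  set a := hermiteFun n (Real.sqrt ((n : ℝ) / 2) * x)
  set b := hermiteFun (n - 1) (Real.sqrt ((n : ℝ) / 2) * x)
  set c := hermiteFun n (Real.sqrt ((n : ℝ) / 2) * y)
  set d := hermiteFun (n - 1) (Real.sqrt ((n : ℝ) / 2) * y)
  linear_combination (-(a * d - b * c) ^ 2 / 2) * h

theorem densS_nonneg (n : ℕ) (x : ℝ) : 0 ≤ densS n x :=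
  mul_nonneg (Real.sqrt_nonneg _) (by positivity)

theorem abs_densM_le (n : ℕ) (x : ℝ) : |densM n x| ≤ densS n x / 2 := by
  rw [densM, densS, abs_mul, abs_of_nonneg (Real.sqrt_nonneg _), mul_div_assoc]
  refine mul_le_mul_of_nonneg_left ?_ (Real.sqrt_nonneg _)
  rw [abs_le]
  constructor <;> nlinarith [sq_nonneg (hermiteFun n (Real.sqrt ((n : ℝ) / 2) * x) -
    hermiteFun (n - 1) (Real.sqrt ((n : ℝ) / 2) * x)), sq_nonneg
    (hermiteFun n (Real.sqrt ((n : ℝ) / 2) * x) + hermiteFun (n - 1) (Real.sqrt ((n : ℝ) / 2) * x))]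

theorem abs_densD_le (n : ℕ) (x : ℝ) : |densD n x| ≤ densS n x := by
  rw [densD, densS, abs_mul, abs_of_nonneg (Real.sqrt_nonneg _)]
  refine mul_le_mul_of_nonneg_left ?_ (Real.sqrt_nonneg _)
  rw [abs_le]
  constructor <;> nlinarith [sq_nonneg (hermiteFun n (Real.sqrt ((n : ℝ) / 2) * x)),
    sq_nonneg (hermiteFun (n - 1) (Real.sqrt ((n : ℝ) / 2) * x))]

theorem sqrt_half_pos {n : ℕ} (hn : 1 ≤ n) : 0 < Real.sqrt ((n : ℝ) / 2) :=
  Real.sqrt_pos.2 (div_pos (by exact_mod_cast hn) two_pos)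

theorem isPolyGauss_scaled_mul {n : ℕ} (hn : 1 ≤ n) (j k : ℕ) :
    IsPolyGauss (fun x => hermiteFun j (Real.sqrt ((n : ℝ) / 2) * x) *
      hermiteFun k (Real.sqrt ((n : ℝ) / 2) * x)) :=
  ((isPolyGauss_hermiteFun j).mul (isPolyGauss_hermiteFun k)).comp_mul (sqrt_half_pos hn).ne'

/-- Continuous functions all of whose products with polynomials are integrable. -/
def PolyIntegrable (u : ℝ → ℝ) : Prop :=
  Continuous u ∧ ∀ P : ℝ[X], Integrable (fun x => P.eval x * u x)

/-- `IsPolyGauss` is not stable under sums, as the exponents may differ; the weaker property is, and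
suffices for integration by parts. -/
theorem IsPolyGauss.polyIntegrable {u : ℝ → ℝ} (hu : IsPolyGauss u) : PolyIntegrable u :=
  ⟨hu.continuous, fun P => (hu.polynomial_mul P).integrable⟩

namespace PolyIntegrable

variable {u v : ℝ → ℝ}

theorem integrable (hu : PolyIntegrable u) : Integrable u := by simpa using hu.2 1

theorem add (hu : PolyIntegrable u) (hv : PolyIntegrable v) :
    PolyIntegrable (fun x => u x + v x) :=
  ⟨hu.1.add hv.1, fun P => by simp only [mul_add]; exact (hu.2 P).add (hv.2 P)⟩

theorem polynomial_mul (Q : ℝ[X]) (hu : PolyIntegrable u) :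
    PolyIntegrable (fun x => Q.eval x * u x) :=
  ⟨Q.continuous.mul hu.1, fun P => by simpa only [eval_mul, mul_assoc] using hu.2 (P * Q)⟩

theorem const_mul (c : ℝ) (hu : PolyIntegrable u) : PolyIntegrable (fun x => c * u x) := by
  simpa using hu.polynomial_mul (C c)

theorem id_mul (hu : PolyIntegrable u) : PolyIntegrable (fun x => x * u x) := by
  simpa using hu.polynomial_mul X

theorem sub (hu : PolyIntegrable u) (hv : PolyIntegrable v) :
    PolyIntegrable (fun x => u x - v x) := by
  simpa [sub_eq_add_neg] using hu.add (hv.const_mul (-1))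

theorem bdd_mul_integrable (hu : PolyIntegrable u) {f : ℝ → ℝ} (hf : Continuous f) {B : ℝ}
    (hB : ∀ x, |f x| ≤ B) : Integrable (fun x => f x * u x) :=
  hu.integrable.bdd_mul hf.aestronglyMeasurable (c := B) (ae_of_all _ hB)

end PolyIntegrable

theorem polyIntegrable_densS {n : ℕ} (hn : 1 ≤ n) : PolyIntegrable (densS n) := by
  have := (((isPolyGauss_scaled_mul hn n n).polyIntegrable.add
    (isPolyGauss_scaled_mul hn (n - 1) (n - 1)).polyIntegrable).const_mul (Real.sqrt ((n : ℝ) / 2)))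
  simp only [← sq] at this
  exact this

theorem polyIntegrable_densD {n : ℕ} (hn : 1 ≤ n) : PolyIntegrable (densD n) := by
  have := (((isPolyGauss_scaled_mul hn n n).polyIntegrable.sub
    (isPolyGauss_scaled_mul hn (n - 1) (n - 1)).polyIntegrable).const_mul (Real.sqrt ((n : ℝ) / 2)))
  simp only [← sq] at this
  exact this

theorem polyIntegrable_densM {n : ℕ} (hn : 1 ≤ n) : PolyIntegrable (densM n) :=
  (isPolyGauss_scaled_mul hn n (n - 1)).polyIntegrable.const_mul _

theorem integral_densS {n : ℕ} (hn : 1 ≤ n) : ∫ x, densS n x = 2 := by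
  have hp := sqrt_half_pos hn
  have key : ∀ k, ∫ x, hermiteFun k (Real.sqrt ((n : ℝ) / 2) * x) ^ 2
      = (Real.sqrt ((n : ℝ) / 2))⁻¹ := by
    intro k
    rw [Measure.integral_comp_mul_left (fun t => hermiteFun k t ^ 2), integral_hermiteFun_sq,
      abs_of_pos (inv_pos.2 hp), smul_eq_mul, mul_one]
  have hi : ∀ k, Integrable (fun x => hermiteFun k (Real.sqrt ((n : ℝ) / 2) * x) ^ 2) := by
    intro k
    simpa only [← sq] using (isPolyGauss_scaled_mul hn k k).integrable
  simp only [densS]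
  rw [integral_const_mul, integral_add (hi _) (hi _), key, key]
  field_simp
  norm_num

/-! ### The first order differential system for S, D and M -/

section

variable {n : ℕ}

theorem hasDerivAt_scaled_top (hn : 1 ≤ n) (x : ℝ) :
    HasDerivAt (fun x => hermiteFun n (Real.sqrt ((n : ℝ) / 2) * x))
      (n * (-(x / 2) * hermiteFun n (Real.sqrt ((n : ℝ) / 2) * x) +
        hermiteFun (n - 1) (Real.sqrt ((n : ℝ) / 2) * x))) x := by
  obtain ⟨m, rfl⟩ : ∃ m, n = m + 1 := ⟨n - 1, by omega⟩
  have h := (hasDerivAt_hermiteFun_succ m (Real.sqrt (((m + 1 : ℕ) : ℝ) / 2) * x)).comp x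
    ((hasDerivAt_id x).const_mul (Real.sqrt (((m + 1 : ℕ) : ℝ) / 2)))
  refine h.congr_deriv ?_
  have h1 : Real.sqrt (((m + 1 : ℕ) : ℝ) / 2) * Real.sqrt (((m + 1 : ℕ) : ℝ) / 2)
      = ((m + 1 : ℕ) : ℝ) / 2 := Real.mul_self_sqrt (by positivity)
  have h2 : Real.sqrt (2 * (m + 1 : ℝ)) = 2 * Real.sqrt (((m + 1 : ℕ) : ℝ) / 2) := by
    rw [show (2 * (m + 1 : ℝ)) = 2 ^ 2 * (((m + 1 : ℕ) : ℝ) / 2) by push_cast; ring,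
      Real.sqrt_mul (by norm_num), Real.sqrt_sq (by norm_num)]
  rw [h2]
  simp only [Nat.add_sub_cancel, mul_one]
  linear_combination (-x * hermiteFun (m + 1) (Real.sqrt (((m + 1 : ℕ) : ℝ) / 2) * x)
    + 2 * hermiteFun m (Real.sqrt (((m + 1 : ℕ) : ℝ) / 2) * x)) * h1

theorem hasDerivAt_scaled_pred (hn : 1 ≤ n) (x : ℝ) :
    HasDerivAt (fun x => hermiteFun (n - 1) (Real.sqrt ((n : ℝ) / 2) * x))
      (n * (x / 2 * hermiteFun (n - 1) (Real.sqrt ((n : ℝ) / 2) * x) -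
        hermiteFun n (Real.sqrt ((n : ℝ) / 2) * x))) x := by
  obtain ⟨m, rfl⟩ : ∃ m, n = m + 1 := ⟨n - 1, by omega⟩
  have h := (hasDerivAt_hermiteFun m (Real.sqrt (((m + 1 : ℕ) : ℝ) / 2) * x)).comp x
    ((hasDerivAt_id x).const_mul (Real.sqrt (((m + 1 : ℕ) : ℝ) / 2)))
  refine h.congr_deriv ?_
  have h1 : Real.sqrt (((m + 1 : ℕ) : ℝ) / 2) * Real.sqrt (((m + 1 : ℕ) : ℝ) / 2)
      = ((m + 1 : ℕ) : ℝ) / 2 := Real.mul_self_sqrt (by positivity)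
  have h2 : Real.sqrt (2 * (m + 1 : ℝ)) = 2 * Real.sqrt (((m + 1 : ℕ) : ℝ) / 2) := by
    rw [show (2 * (m + 1 : ℝ)) = 2 ^ 2 * (((m + 1 : ℕ) : ℝ) / 2) by push_cast; ring,
      Real.sqrt_mul (by norm_num), Real.sqrt_sq (by norm_num)]
  rw [h2]
  simp only [Nat.add_sub_cancel, mul_one]
  linear_combination (x * hermiteFun m (Real.sqrt (((m + 1 : ℕ) : ℝ) / 2) * x)
    - 2 * hermiteFun (m + 1) (Real.sqrt (((m + 1 : ℕ) : ℝ) / 2) * x)) * h1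

theorem hasDerivAt_densS (hn : 1 ≤ n) (x : ℝ) :
    HasDerivAt (densS n) (-(n * (x * densD n x))) x := by
  refine (((hasDerivAt_scaled_top hn x).pow 2).add
    ((hasDerivAt_scaled_pred hn x).pow 2)).const_mul (Real.sqrt ((n : ℝ) / 2)) |>.congr_deriv ?_
  simp only [densD]
  push_cast
  ring

theorem hasDerivAt_densD (hn : 1 ≤ n) (x : ℝ) :
    HasDerivAt (densD n) (n * (4 * densM n x - x * densS n x)) x := by
  refine (((hasDerivAt_scaled_top hn x).pow 2).sub
    ((hasDerivAt_scaled_pred hn x).pow 2)).const_mul (Real.sqrt ((n : ℝ) / 2)) |>.congr_deriv ?_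
  simp only [densS, densM]
  push_cast
  ring

theorem hasDerivAt_densM (hn : 1 ≤ n) (x : ℝ) :
    HasDerivAt (densM n) (-(n * densD n x)) x := by
  refine ((hasDerivAt_scaled_top hn x).mul (hasDerivAt_scaled_pred hn x)).const_mul
    (Real.sqrt ((n : ℝ) / 2)) |>.congr_deriv ?_
  simp only [densD]
  ring

/-! ### Weak form of the differential equations -/

theorem integral_mul_deriv_eq {f f' u u' : ℝ → ℝ} (hf : ∀ x, HasDerivAt f (f' x) x)
    (hu : ∀ x, HasDerivAt u (u' x) x) (h1 : Integrable (fun x => f x * u' x))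
    (h2 : Integrable (fun x => f' x * u x)) (h3 : Integrable (fun x => f x * u x)) :
    ∫ x, f x * u' x = -∫ x, f' x * u x :=
  integral_mul_deriv_eq_deriv_mul_of_integrable (fun x _ => hf x) (fun x _ => hu x) h1 h2 h3

theorem integral_mul_densD (hn : 1 ≤ n) {f f' : ℝ → ℝ} (hf : ∀ x, HasDerivAt f (f' x) x)
    (hc : Continuous f') {B B' : ℝ} (hB : ∀ x, |f x| ≤ B) (hB' : ∀ x, |f' x| ≤ B') :
    n * ∫ x, f x * densD n x = ∫ x, f' x * densM n x := by
  have cf : Continuous f := continuous_iff_continuousAt.2 fun x => (hf x).continuousAt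
  have h := integral_mul_deriv_eq hf (hasDerivAt_densM hn)
    (((polyIntegrable_densD hn).bdd_mul_integrable cf hB).const_mul (-(n : ℝ)) |>.congr
      (ae_of_all _ fun x => by ring))
    ((polyIntegrable_densM hn).bdd_mul_integrable hc hB')
    ((polyIntegrable_densM hn).bdd_mul_integrable cf hB)
  rw [← integral_const_mul, ← neg_eq_iff_eq_neg.2 h.symm.symm, ← integral_neg]
  congr 1
  ext x
  ring

/-- Integrate the equation for D' against f, then use `integral_mul_densD` for f' to trade D for M.
Each of the two steps gives one factor 1/n. -/
theorem integral_id_mul_densS_sub (hn : 1 ≤ n) {f f' f'' : ℝ → ℝ}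
    (hf : ∀ x, HasDerivAt f (f' x) x) (hf' : ∀ x, HasDerivAt f' (f'' x) x) (hc : Continuous f'')
    {B B' B'' : ℝ} (hB : ∀ x, |f x| ≤ B) (hB' : ∀ x, |f' x| ≤ B') (hB'' : ∀ x, |f'' x| ≤ B'') :
    (∫ x, f x * (x * densS n x)) - 4 * ∫ x, f x * densM n x
      = ((n : ℝ) ^ 2)⁻¹ * ∫ x, f'' x * densM n x := by
  have cf : Continuous f := continuous_iff_continuousAt.2 fun x => (hf x).continuousAt
  have cf' : Continuous f' := continuous_iff_continuousAt.2 fun x => (hf' x).continuousAt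
  have i1 := (polyIntegrable_densM hn).bdd_mul_integrable cf hB
  have i2 := (polyIntegrable_densS hn).id_mul.bdd_mul_integrable cf hB
  have h := integral_mul_deriv_eq hf (hasDerivAt_densD hn)
    (((i1.const_mul 4).sub i2).const_mul (n : ℝ) |>.congr (ae_of_all _ fun x => by
      simp only [Pi.sub_apply]; ring))
    ((polyIntegrable_densD hn).bdd_mul_integrable cf' hB')
    ((polyIntegrable_densD hn).bdd_mul_integrable cf hB)
  have h2 := integral_mul_densD hn hf' hc hB' hB''
  have h3 : ∫ x, f x * (n * (4 * densM n x - x * densS n x))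
      = n * (4 * (∫ x, f x * densM n x) - ∫ x, f x * (x * densS n x)) := by
    rw [← integral_const_mul 4, ← integral_sub (i1.const_mul 4) i2, ← integral_const_mul]
    congr 1
    ext x
    ring
  rw [h3] at h
  have hn0 : (n : ℝ) ≠ 0 := by exact_mod_cast (by omega : n ≠ 0)
  rw [← h2]
  generalize (∫ x, f x * (x * densS n x)) = a at *
  generalize (∫ x, f x * densM n x) = b at *
  generalize (∫ x, f' x * densD n x) = c at *
  field_simp
  linarith

/-- Both sides equal n∫ x f D, since S' = x M' = -n x D. -/
theorem integral_deriv_mul_densS (hn : 1 ≤ n) {f f' : ℝ → ℝ} (hf : ∀ x, HasDerivAt f (f' x) x)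
    (hc : Continuous f') {B B' : ℝ} (hB : ∀ x, |f x| ≤ B) (hB' : ∀ x, |f' x| ≤ B') :
    ∫ x, f' x * densS n x = ∫ x, (f x + x * f' x) * densM n x := by
  have cf : Continuous f := continuous_iff_continuousAt.2 fun x => (hf x).continuousAt
  have i1 := (polyIntegrable_densD hn).id_mul.bdd_mul_integrable cf hB
  have i2 := (polyIntegrable_densM hn).bdd_mul_integrable cf hB
  have i3 := (polyIntegrable_densM hn).id_mul.bdd_mul_integrable hc hB'
  have i4 := (polyIntegrable_densM hn).id_mul.bdd_mul_integrable cf hB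
  have h1 := integral_mul_deriv_eq hf (hasDerivAt_densS hn)
    (i1.const_mul (-(n : ℝ)) |>.congr (ae_of_all _ fun x => by ring))
    ((polyIntegrable_densS hn).bdd_mul_integrable hc hB')
    ((polyIntegrable_densS hn).bdd_mul_integrable cf hB)
  have hxf : ∀ x, HasDerivAt (fun x => x * f x) (f x + x * f' x) x := fun x =>
    ((hasDerivAt_id x).mul (hf x)).congr_deriv (by simp)
  have h2 := integral_mul_deriv_eq hxf (hasDerivAt_densM hn)
    (i1.const_mul (-(n : ℝ)) |>.congr (ae_of_all _ fun x => by ring))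
    ((i2.add i3).congr (ae_of_all _ fun x => by simp only [Pi.add_apply]; ring))
    (i4.congr (ae_of_all _ fun x => by ring))
  have h3 : ∫ x, f x * -(n * (x * densD n x)) = ∫ x, x * f x * -(n * densD n x) := by
    congr 1
    ext x
    ring
  linarith

end

end GUEExpansion

namespace GUEExpansion

open MeasureTheory Filter Topology

/-! ### Asymptotic expansions in powers of `n⁻²` -/

/-- The expansion parameter `n⁻²`. -/
noncomputable def eps (n : ℕ) : ℝ := ((n : ℝ) ^ 2)⁻¹

theorem eps_pos {n : ℕ} (hn : 1 ≤ n) : 0 < eps n :=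
  inv_pos.2 (pow_pos (by exact_mod_cast hn) 2)

theorem eps_nonneg (n : ℕ) : 0 ≤ eps n := by unfold eps; positivity

theorem eps_le_one (n : ℕ) : eps n ≤ 1 := by
  rcases Nat.eq_zero_or_pos n with rfl | hn
  · simp [eps]
  · exact inv_le_one_of_one_le₀ (one_le_pow₀ (by exact_mod_cast hn))

theorem eps_pow_le_one (n k : ℕ) : eps n ^ k ≤ 1 := pow_le_one₀ (eps_nonneg n) (eps_le_one n)

theorem tendsto_eps : Tendsto eps atTop (𝓝 0) :=
  tendsto_inv_atTop_zero.comp ((tendsto_pow_atTop two_ne_zero).comp tendsto_natCast_atTop_atTop)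

theorem eps_injective : Function.Injective eps := by
  intro m n h
  have h' : (m : ℝ) ^ 2 = (n : ℝ) ^ 2 := inv_injective h
  exact_mod_cast (pow_left_inj₀ m.cast_nonneg n.cast_nonneg two_ne_zero).1 h'

/-- `F n = ∑_{j<k} a_j n^{-2j} + R n` with `|R n| ≤ K n^{-2k}` for all `n ≥ 1`. -/
def ExpandsWith (a : ℕ → ℝ) (k : ℕ) (K : ℝ) (F : ℕ → ℝ) : Prop :=
  ∀ n, 1 ≤ n → |F n - ∑ j ∈ Finset.range k, a j * eps n ^ j| ≤ K * eps n ^ k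

/-- `F` has an expansion of order `k` in powers of `n⁻²` with remainder constant `K`. -/
def HasExp (k : ℕ) (K : ℝ) (F : ℕ → ℝ) : Prop := ∃ a, ExpandsWith a k K F

theorem ExpandsWith.truncate {a : ℕ → ℝ} {k : ℕ} {K : ℝ} {F : ℕ → ℝ} (h : ExpandsWith a k K F)
    {j : ℕ} (hj : j ≤ k) : ∃ K', ExpandsWith a j K' F := by
  induction hj using Nat.decreasingInduction with
  | self => exact ⟨K, h⟩
  | of_succ j hj ih =>
    obtain ⟨K', h'⟩ := ih
    refine ⟨|K'| + |a j|, fun n hn => ?_⟩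
    have h1 := h' n hn
    rw [Finset.sum_range_succ] at h1
    have h2 : |a j * eps n ^ j| = |a j| * eps n ^ j := by
      rw [abs_mul, abs_of_nonneg (pow_nonneg (eps_nonneg n) j)]
    have h3 : K' * eps n ^ (j + 1) ≤ |K'| * eps n ^ j := by
      rw [pow_succ]
      have := pow_nonneg (eps_nonneg n) j
      calc K' * (eps n ^ j * eps n) ≤ |K'| * (eps n ^ j * 1) := by
            refine mul_le_mul (le_abs_self _) ?_ (mul_nonneg this (eps_nonneg n)) (abs_nonneg _)
            exact mul_le_mul_of_nonneg_left (eps_le_one n) this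
        _ = _ := by ring
    calc |F n - ∑ i ∈ Finset.range j, a i * eps n ^ i|
        = |(F n - (∑ i ∈ Finset.range j, a i * eps n ^ i + a j * eps n ^ j)) + a j * eps n ^ j| := by
          congr 1; ring
      _ ≤ _ := abs_add_le _ _
      _ ≤ |K'| * eps n ^ j + |a j| * eps n ^ j := by rw [h2]; exact add_le_add (h1.trans h3) le_rfl
      _ = _ := by ring

namespace HasExp

variable {k : ℕ} {K K' : ℝ} {F G : ℕ → ℝ}

theorem congr (h : HasExp k K F) (hFG : ∀ n, 1 ≤ n → F n = G n) : HasExp k K G := by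
  obtain ⟨a, ha⟩ := h
  exact ⟨a, fun n hn => hFG n hn ▸ ha n hn⟩

theorem mono (h : HasExp k K F) (hK : K ≤ K') : HasExp k K' F := by
  obtain ⟨a, ha⟩ := h
  exact ⟨a, fun n hn => (ha n hn).trans
    (mul_le_mul_of_nonneg_right hK (pow_nonneg (eps_nonneg n) k))⟩

theorem of_small (h : ∀ n, 1 ≤ n → |F n| ≤ K * eps n ^ k) : HasExp k K F :=
  ⟨0, fun n hn => by simpa using h n hn⟩

theorem add (hF : HasExp k K F) (hG : HasExp k K' G) : HasExp k (K + K') (fun n => F n + G n) := by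
  obtain ⟨a, ha⟩ := hF
  obtain ⟨b, hb⟩ := hG
  refine ⟨fun j => a j + b j, fun n hn => ?_⟩
  simp only [add_mul, Finset.sum_add_distrib]
  rw [add_sub_add_comm]
  exact (abs_add_le _ _).trans (add_le_add (ha n hn) (hb n hn))

theorem const_mul (c : ℝ) (hF : HasExp k K F) : HasExp k (|c| * K) (fun n => c * F n) := by
  obtain ⟨a, ha⟩ := hF
  refine ⟨fun j => c * a j, fun n hn => ?_⟩
  simp only [mul_assoc]
  rw [← Finset.mul_sum, ← mul_sub, abs_mul]
  exact mul_le_mul_of_nonneg_left (ha n hn) (abs_nonneg c)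

theorem const (k : ℕ) (c : ℝ) : HasExp (k + 1) 0 (fun _ => c) := by
  refine ⟨fun j => if j = 0 then c else 0, fun n _ => ?_⟩
  rw [Finset.sum_range_succ']
  simp

theorem eps_mul (hF : HasExp k K F) : HasExp (k + 1) K (fun n => eps n * F n) := by
  obtain ⟨a, ha⟩ := hF
  refine ⟨fun j => if j = 0 then 0 else a (j - 1), fun n hn => ?_⟩
  rw [Finset.sum_range_succ']
  simp only [Nat.add_eq_zero_iff, one_ne_zero, and_false, if_false, Nat.add_sub_cancel, if_true,
    zero_mul, add_zero]
  have : ∑ j ∈ Finset.range k, a j * eps n ^ (j + 1)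
      = eps n * ∑ j ∈ Finset.range k, a j * eps n ^ j := by
    rw [Finset.mul_sum]
    exact Finset.sum_congr rfl fun j _ => by ring
  rw [this, ← mul_sub, abs_mul, abs_of_nonneg (eps_nonneg n)]
  calc _ ≤ eps n * (K * eps n ^ k) := mul_le_mul_of_nonneg_left (ha n hn) (eps_nonneg n)
    _ = _ := by ring

theorem pred (hF : HasExp (k + 1) K F) : ∃ K', HasExp k K' F := by
  obtain ⟨a, ha⟩ := hF
  obtain ⟨K', h⟩ := ha.truncate k.le_succ
  exact ⟨K', a, h⟩

theorem sum {ι : Type*} (s : Finset ι) {F : ι → ℕ → ℝ} (h : ∀ i ∈ s, ∃ K, HasExp k K (F i)) :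
    ∃ K, HasExp k K (fun n => ∑ i ∈ s, F i n) := by
  classical
  induction s using Finset.induction_on with
  | empty => exact ⟨0, of_small fun n _ => by simp⟩
  | insert i s hi ih =>
    obtain ⟨K₁, h₁⟩ := h i (Finset.mem_insert_self i s)
    obtain ⟨K₂, h₂⟩ := ih fun j hj => h j (Finset.mem_insert_of_mem hj)
    exact ⟨K₁ + K₂, (h₁.add h₂).congr fun n _ => by rw [Finset.sum_insert hi]⟩

theorem eps_pow_mul (hF : HasExp k K F) (j : ℕ) :
    ∃ K', HasExp k K' (fun n => eps n ^ j * F n) := by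
  induction j with
  | zero => exact ⟨K, hF.congr fun n _ => by simp⟩
  | succ j ih =>
    obtain ⟨K', h⟩ := ih
    obtain ⟨K'', h'⟩ := h.eps_mul.pred
    exact ⟨K'', h'.congr fun n _ => by ring⟩

end HasExp

/-- Letting n tend to infinity kills the constant coefficient; then divide by `eps n` and induct. -/
theorem eq_zero_of_expandsWith_zero {k : ℕ} {K : ℝ} {d : ℕ → ℝ}
    (h : ∀ n, 1 ≤ n → |∑ j ∈ Finset.range k, d j * eps n ^ j| ≤ K * eps n ^ k) :
    ∀ j < k, d j = 0 := by
  induction k generalizing d with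
  | zero => intro j hj; omega
  | succ k ih =>
    have h0 : d 0 = 0 := by
      have t1 : Tendsto (fun n => ∑ j ∈ Finset.range (k + 1), d j * eps n ^ j) atTop
          (𝓝 (∑ j ∈ Finset.range (k + 1), d j * 0 ^ j)) :=
        tendsto_finsetSum _ fun j _ => (tendsto_eps.pow j).const_mul (d j)
      have t2 : Tendsto (fun n => K * eps n ^ (k + 1)) atTop (𝓝 (K * 0 ^ (k + 1))) :=
        (tendsto_eps.pow _).const_mul K
      have := le_of_tendsto_of_tendsto t1.abs t2 (eventually_atTop.2 ⟨1, fun n hn => h n hn⟩)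
      rw [Finset.sum_range_succ'] at this
      simpa using this
    intro j hj
    rcases j with _ | j
    · exact h0
    refine ih (d := fun j => d (j + 1)) (fun n hn => ?_) j (by omega)
    have h1 := h n hn
    rw [Finset.sum_range_succ', h0] at h1
    have h2 : ∑ j ∈ Finset.range k, d (j + 1) * eps n ^ (j + 1)
        = eps n * ∑ j ∈ Finset.range k, d (j + 1) * eps n ^ j := by
      rw [Finset.mul_sum]
      exact Finset.sum_congr rfl fun j _ => by ring
    rw [zero_mul, add_zero, h2, abs_mul, abs_of_nonneg (eps_nonneg n)] at h1
    refine le_of_mul_le_mul_left ?_ (eps_pos hn)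
    calc _ ≤ _ := h1
      _ = _ := by ring

theorem ExpandsWith.coeff_unique {a b : ℕ → ℝ} {k : ℕ} {K L : ℝ} {F : ℕ → ℝ}
    (ha : ExpandsWith a k K F) (hb : ExpandsWith b k L F) : ∀ j < k, a j = b j := by
  intro j hj
  refine sub_eq_zero.1 (eq_zero_of_expandsWith_zero (d := fun j => a j - b j) (K := K + L)
    (fun n hn => ?_) j hj)
  simp only [sub_mul, Finset.sum_sub_distrib]
  rw [abs_sub_comm]
  calc _ = |(F n - ∑ j ∈ Finset.range k, a j * eps n ^ j)
        - (F n - ∑ j ∈ Finset.range k, b j * eps n ^ j)| := by congr 1; ring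
    _ ≤ _ := abs_sub _ _
    _ ≤ _ := add_le_add (ha n hn) (hb n hn)
    _ = _ := by ring

theorem exists_expandsWith_of_forall_hasExp {K : ℕ → ℝ} {F : ℕ → ℝ} (h : ∀ k, HasExp k (K k) F) :
    ∃ a, ∀ k, ExpandsWith a k (K k) F := by
  choose a ha using h
  -- Coefficient j is read off from the first expansion that contains it; uniqueness makes all
  -- longer ones agree.
  refine ⟨fun j => a (j + 1) j, fun k n hn => ?_⟩
  have : ∑ j ∈ Finset.range k, a (j + 1) j * eps n ^ j
      = ∑ j ∈ Finset.range k, a k j * eps n ^ j := by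
    refine Finset.sum_congr rfl fun j hj => ?_
    obtain ⟨K', h'⟩ := (ha k).truncate (Nat.succ_le_of_lt (Finset.mem_range.1 hj))
    rw [(ha (j + 1)).coeff_unique h' j j.lt_succ_self]
  rw [this]
  exact ha k n hn

/-- The points `eps 1`, ..., `eps k` are distinct, so their Vandermonde matrix is injective: the
first k values control the coefficients. -/
theorem exists_coeff_bound (k : ℕ) : ∃ C : ℝ, ∀ (a : Fin k → ℝ) (A : ℝ), 0 ≤ A →
    (∀ n, 1 ≤ n → n ≤ k → |∑ j, a j * eps n ^ (j : ℕ)| ≤ A) → ‖a‖ ≤ C * A := by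
  have hinj : Function.Injective (fun i : Fin k => eps (i + 1)) := fun i j h =>
    Fin.ext (by simpa using eps_injective h)
  have hker : (Matrix.toLin' (Matrix.vandermonde fun i : Fin k => eps (i + 1))).ker = ⊥ := by
    rw [LinearMap.ker_eq_bot']
    intro m hm
    refine Matrix.eq_zero_of_mulVec_eq_zero (Matrix.det_vandermonde_ne_zero_iff.2 hinj) ?_
    simpa using hm
  obtain ⟨C, -, hC⟩ := LinearMap.exists_antilipschitzWith _ hker
  refine ⟨C, fun a A hA h => ?_⟩
  have h1 := hC.le_mul_dist a 0
  rw [map_zero, dist_zero_right, dist_zero_right] at h1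
  refine h1.trans (mul_le_mul_of_nonneg_left ?_ C.2)
  rw [pi_norm_le_iff_of_nonneg hA]
  intro i
  have h2 := h (i + 1) (by omega) (by omega)
  have h3 : Matrix.toLin' (Matrix.vandermonde fun i : Fin k => eps (i + 1)) a i
      = ∑ j, a j * eps (i + 1) ^ (j : ℕ) := by
    simp only [Matrix.toLin'_apply, Matrix.mulVec, dotProduct, Matrix.vandermonde_apply]
    exact Finset.sum_congr rfl fun j _ => mul_comm _ _
  rw [h3]
  exact h2

/-- The approximants' coefficients are bounded by `exists_coeff_bound`, so a subsequence converges,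
and the remainder estimate passes to the limit for each n. Approximants need no common coefficients,
only remainder constants tending to K. -/
theorem HasExp.of_uniform_approx {k : ℕ} {K : ℝ} {F : ℕ → ℝ}
    (h : ∀ δ > 0, ∃ G, HasExp k (K + δ) G ∧ ∀ n, 1 ≤ n → |F n - G n| ≤ δ) : HasExp k K F := by
  have hδ : ∀ i : ℕ, (0 : ℝ) < 1 / ((i : ℝ) + 1) := fun i => by positivity
  have hδ1 : ∀ i : ℕ, 1 / ((i : ℝ) + 1) ≤ 1 := fun i =>
    (div_le_one (by positivity)).2 (by have : (0 : ℝ) ≤ i := i.cast_nonneg; linarith)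
  have hlim : Tendsto (fun i : ℕ => 1 / ((i : ℝ) + 1)) atTop (𝓝 0) :=
    tendsto_one_div_add_atTop_nhds_zero_nat
  choose G hG hFG using fun i : ℕ => h _ (hδ i)
  choose a ha using hG
  obtain ⟨C, hC⟩ := exists_coeff_bound k
  -- A bounds the approximating sums for n ≤ k: |F n|, plus an approximation error at most 1, plus a
  -- remainder at most |K| + 1.
  set A : ℝ := ∑ n ∈ Finset.range (k + 1), |F n| + 1 + (|K| + 1) with hA
  have hA0 : 0 ≤ A := by positivity
  have hbd : ∀ i, ‖(fun j : Fin k => a i j)‖ ≤ C * A := by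
    intro i
    refine hC _ A hA0 fun n hn hnk => ?_
    have h1 := ha i n hn
    have h2 := hFG i n hn
    have h3 : |F n| ≤ ∑ n ∈ Finset.range (k + 1), |F n| :=
      Finset.single_le_sum (f := fun n => |F n|) (fun _ _ => abs_nonneg _)
        (Finset.mem_range.2 (by omega))
    have h4 : (K + 1 / ((i : ℝ) + 1)) * eps n ^ k ≤ |K| + 1 := by
      calc _ ≤ (|K| + 1) * 1 := by
            refine mul_le_mul (add_le_add (le_abs_self K) (hδ1 i)) (eps_pow_le_one n k)
              (pow_nonneg (eps_nonneg n) k) (by positivity)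
        _ = _ := mul_one _
    rw [Fin.sum_univ_eq_sum_range (fun j => a i j * eps n ^ j) k]
    have h5 : ∑ j ∈ Finset.range k, a i j * eps n ^ j = F n - (F n - G i n)
        - (G i n - ∑ j ∈ Finset.range k, a i j * eps n ^ j) := by ring
    rw [h5]
    refine (abs_sub _ _).trans ((add_le_add_left (abs_sub _ _) _).trans ?_)
    have := hδ1 i
    linarith
  obtain ⟨c, -, φ, hφ, hc⟩ := tendsto_subseq_of_bounded
    (Metric.isBounded_closedBall (x := (0 : Fin k → ℝ)) (r := C * A))
    (x := fun i j => a i j) fun i => by simpa using hbd i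
  refine ⟨fun j => if hj : j < k then c ⟨j, hj⟩ else 0, fun n hn => ?_⟩
  have hcj : ∀ j : Fin k, Tendsto (fun i => a (φ i) j) atTop (𝓝 (c j)) := fun j =>
    (tendsto_pi_nhds.1 hc) j
  have e : ∑ j ∈ Finset.range k, (if hj : j < k then c ⟨j, hj⟩ else 0) * eps n ^ j
      = ∑ j : Fin k, c j * eps n ^ (j : ℕ) := by
    rw [← Fin.sum_univ_eq_sum_range]
    exact Finset.sum_congr rfl fun j _ => by simp
  rw [e]
  have hl' := hlim.comp hφ.tendsto_atTop
  have t1 : Tendsto (fun i => |F n - ∑ j : Fin k, a (φ i) j * eps n ^ (j : ℕ)|) atTop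
      (𝓝 |F n - ∑ j : Fin k, c j * eps n ^ (j : ℕ)|) :=
    (tendsto_const_nhds.sub (tendsto_finsetSum _ fun j _ => (hcj j).mul_const _)).abs
  have t2 : Tendsto (fun i : ℕ => 1 / (((φ i : ℕ) : ℝ) + 1) +
      (K + 1 / (((φ i : ℕ) : ℝ) + 1)) * eps n ^ k) atTop (𝓝 (0 + (K + 0) * eps n ^ k)) :=
    hl'.add ((tendsto_const_nhds.add hl').mul_const _)
  have := le_of_tendsto_of_tendsto' t1 t2 fun i => ?_
  · simpa using this
  · have h1 := ha (φ i) n hn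
    have h2 := hFG (φ i) n hn
    rw [Fin.sum_univ_eq_sum_range (fun j => a (φ i) j * eps n ^ j) k]
    calc _ = |(F n - G (φ i) n) + (G (φ i) n - ∑ j ∈ Finset.range k, a (φ i) j * eps n ^ j)| := by
          congr 1; ring
      _ ≤ _ := abs_add_le _ _
      _ ≤ _ := add_le_add h2 h1

end GUEExpansion

namespace GUEExpansion

open MeasureTheory Filter Topology Set Polynomial

/-! ### Iterated derivatives of smooth functions on the line -/

theorem contDiff_iteratedDeriv {f : ℝ → ℝ} (hf : ContDiff ℝ ∞ f) (j : ℕ) :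
    ContDiff ℝ ∞ (iteratedDeriv j f) := by
  induction j with
  | zero => simpa using hf
  | succ j ih =>
    rw [iteratedDeriv_succ]
    exact (contDiff_infty_iff_deriv.1 ih).2

theorem hasDerivAt_iteratedDeriv {f : ℝ → ℝ} (hf : ContDiff ℝ ∞ f) (j : ℕ) (x : ℝ) :
    HasDerivAt (iteratedDeriv j f) (iteratedDeriv (j + 1) f x) x := by
  rw [iteratedDeriv_succ]
  exact ((contDiff_infty_iff_deriv.1 (contDiff_iteratedDeriv hf j)).1 x).hasDerivAt

theorem iteratedDeriv_iteratedDeriv (f : ℝ → ℝ) (i j : ℕ) :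
    iteratedDeriv i (iteratedDeriv j f) = iteratedDeriv (i + j) f := by
  rw [iteratedDeriv_eq_iterate, iteratedDeriv_eq_iterate, iteratedDeriv_eq_iterate,
    Function.iterate_add_apply]

theorem contDiff_polynomial_eval (p : ℝ[X]) : ContDiff ℝ ∞ (fun x => p.eval x) := by
  simpa using p.contDiff_aeval (𝕜 := ℝ) ∞

theorem iteratedDeriv_eq_zero_of_eqOn {f : ℝ → ℝ} {s : Set ℝ} (hs : IsOpen s)
    (h : ∀ x ∈ s, f x = 0) (j : ℕ) {x : ℝ} (hx : x ∈ s) : iteratedDeriv j f x = 0 := by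
  have := Set.EqOn.iteratedDeriv_of_isOpen (f := f) (g := fun _ => (0 : ℝ)) h hs j hx
  rw [this]
  rcases j with _ | j
  · simp
  · simp

theorem exists_bound_of_eq_zero_off_Icc {f : ℝ → ℝ} (hf : Continuous f) {r : ℝ}
    (h : ∀ x, x ∉ Icc (-r) r → f x = 0) : ∃ C, 0 ≤ C ∧ ∀ x, |f x| ≤ C := by
  obtain ⟨C, hC⟩ := (isCompact_Icc (a := -r) (b := r)).exists_bound_of_continuousOn hf.continuousOn
  refine ⟨max C 0, le_max_right _ _, fun x => ?_⟩
  by_cases hx : x ∈ Icc (-r) r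
  · exact (hC x hx).trans (le_max_left _ _)
  · rw [h x hx, abs_zero]
    exact le_max_right _ _

/-- Leibniz rule. Only bounds on [-3,3] are asked of f, because it will be a polynomial, and C
depends on η and N alone. -/
theorem exists_bound_iteratedDeriv_mul {η : ℝ → ℝ} (hη : ContDiff ℝ ∞ η)
    (hs : ∀ x, x ∉ Icc (-3 : ℝ) 3 → η x = 0) (N : ℕ) :
    ∃ C, 0 ≤ C ∧ ∀ (f : ℝ → ℝ) (B : ℝ), ContDiff ℝ ∞ f →
      (∀ j ≤ N, ∀ x ∈ Icc (-3 : ℝ) 3, |iteratedDeriv j f x| ≤ B) →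
      ∀ j ≤ N, ∀ x, |iteratedDeriv j (fun x => η x * f x) x| ≤ C * B := by
  have hz : ∀ i x, x ∉ Icc (-3 : ℝ) 3 → iteratedDeriv i η x = 0 := fun i x hx =>
    iteratedDeriv_eq_zero_of_eqOn (s := (Icc (-3 : ℝ) 3)ᶜ) isClosed_Icc.isOpen_compl hs i hx
  choose c hc0 hc using fun i => exists_bound_of_eq_zero_off_Icc
    (contDiff_iteratedDeriv hη i).continuous (hz i)
  refine ⟨∑ j ∈ Finset.range (N + 1), ∑ i ∈ Finset.range (j + 1), (j.choose i : ℝ) * c i,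
    Finset.sum_nonneg fun j _ => Finset.sum_nonneg fun i _ => mul_nonneg (Nat.cast_nonneg _) (hc0 i),
    fun f B hf hB j hj x => ?_⟩
  have hB0 : 0 ≤ B := (abs_nonneg _).trans (hB 0 (Nat.zero_le _) 0 (by norm_num))
  have hmul := iteratedDeriv_mul (n := j) (x := x) (hη.contDiffAt.of_le (by exact_mod_cast le_top))
    (hf.contDiffAt.of_le (by exact_mod_cast le_top))
  have h1 : |iteratedDeriv j (fun x => η x * f x) x|
      ≤ (∑ i ∈ Finset.range (j + 1), (j.choose i : ℝ) * c i) * B := by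
    change |iteratedDeriv j (η * f) x| ≤ _
    rw [hmul, Finset.sum_mul]
    refine (Finset.abs_sum_le_sum_abs _ _).trans (Finset.sum_le_sum fun i hi => ?_)
    rw [abs_mul, abs_mul, Nat.abs_cast, mul_assoc, mul_assoc]
    refine mul_le_mul_of_nonneg_left ?_ (Nat.cast_nonneg _)
    by_cases hx : x ∈ Icc (-3 : ℝ) 3
    · exact mul_le_mul (hc i x) (hB _ (by omega) x hx) (abs_nonneg _) (hc0 i)
    · rw [hz i x hx, abs_zero, zero_mul]
      exact mul_nonneg (hc0 i) hB0
  refine h1.trans (mul_le_mul_of_nonneg_right ?_ hB0)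
  exact Finset.single_le_sum
    (f := fun j => ∑ i ∈ Finset.range (j + 1), (j.choose i : ℝ) * c i)
    (fun j _ => Finset.sum_nonneg fun i _ => mul_nonneg (Nat.cast_nonneg _) (hc0 i))
    (Finset.mem_range.2 (by omega))

/-! ### The operator `f ↦ (4 - x²) f' - x f` -/

/-- The first order operator whose range is annihilated by the arcsine law on `[-2, 2]`. -/
noncomputable def arcsineOp (f : ℝ → ℝ) (x : ℝ) : ℝ := (4 - x ^ 2) * deriv f x - x * f x

/-- For j = 0 the truncated index j - 1 is harmless: its coefficient j² vanishes. -/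
theorem iteratedDeriv_arcsineOp {f : ℝ → ℝ} (hf : ContDiff ℝ ∞ f) (j : ℕ) (x : ℝ) :
    iteratedDeriv j (arcsineOp f) x = (4 - x ^ 2) * iteratedDeriv (j + 1) f x
      - (2 * j + 1) * x * iteratedDeriv j f x - (j : ℝ) ^ 2 * iteratedDeriv (j - 1) f x := by
  induction j generalizing x with
  | zero => simp [arcsineOp, iteratedDeriv_one]
  | succ j ih =>
    rw [iteratedDeriv_succ, funext ih]
    have hp : HasDerivAt (fun x : ℝ => 4 - x ^ 2) (-(2 * x)) x := by
      simpa using (hasDerivAt_pow 2 x).const_sub 4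
    have hq : HasDerivAt (fun x : ℝ => (2 * j + 1) * x) (2 * (j : ℝ) + 1) x := by
      simpa using (hasDerivAt_id x).const_mul (2 * (j : ℝ) + 1)
    have hl : HasDerivAt (fun x => (j : ℝ) ^ 2 * iteratedDeriv (j - 1) f x)
        ((j : ℝ) ^ 2 * iteratedDeriv j f x) x := by
      rcases j with _ | j
      · simpa using hasDerivAt_const x (0 : ℝ)
      · exact (hasDerivAt_iteratedDeriv hf j x).const_mul _
    have h := (((hp.mul (hasDerivAt_iteratedDeriv hf (j + 1) x)).sub
      (hq.mul (hasDerivAt_iteratedDeriv hf j x))).sub hl).deriv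
    refine Eq.trans h ?_
    simp only [Nat.add_sub_cancel]
    push_cast
    ring

/-- A positive second derivative would make x a local minimum too, so h would be locally constant
and the derivative zero. -/
theorem deriv_deriv_nonpos_of_isLocalMax {h : ℝ → ℝ} (hh : ContDiff ℝ ∞ h) {x : ℝ}
    (hx : IsLocalMax h x) : deriv (deriv h) x ≤ 0 := by
  by_contra hpos
  have hmin := isLocalMin_of_deriv_deriv_pos (not_le.1 hpos) hx.deriv_eq_zero
    hh.continuous.continuousAt
  have hconst : h =ᶠ[𝓝 x] fun _ => h x := by
    filter_upwards [hx, hmin] with y h1 h2 using le_antisymm h1 h2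
  have := hconst.deriv.deriv_eq
  simp at this
  exact hpos this.le

/-- At a maximum point of h on [-3,3] where h exceeds U, one of the two bounds fails. The first
order one serves where 4 - x² ≤ 0, the second order one where |x| < 2, so the degeneracy at ±2 does
no harm. -/
theorem le_of_max_principle {h : ℝ → ℝ} (hh : ContDiff ℝ ∞ h) {α β U : ℝ} (hα : 1 ≤ α)
    (hβ : 1 ≤ β) (hu : ∀ x ∈ Icc (-3 : ℝ) 3, |(4 - x ^ 2) * deriv h x - α * x * h x| ≤ U)
    (hv : ∀ x ∈ Icc (-3 : ℝ) 3,
      |(4 - x ^ 2) * deriv (deriv h) x - (α + 2) * x * deriv h x - β * h x| ≤ U) :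
    ∀ x ∈ Icc (-3 : ℝ) 3, h x ≤ U := by
  obtain ⟨x₀, hx₀, hmax⟩ := (isCompact_Icc (a := (-3 : ℝ)) (b := 3)).exists_isMaxOn
    ⟨0, by norm_num⟩ hh.continuous.continuousOn
  intro x hx
  refine (hmax hx).trans ?_
  have hU : 0 ≤ U := (abs_nonneg _).trans (hu x₀ hx₀)
  by_contra hlt
  have hpos : U < h x₀ := not_le.1 hlt
  have hdiff : HasDerivAt h (deriv h x₀) x₀ :=
    ((contDiff_infty_iff_deriv.1 hh).1 x₀).hasDerivAt
  have u1 := abs_le.1 (hu x₀ hx₀)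
  have v1 := abs_le.1 (hv x₀ hx₀)
  have hβh : h x₀ ≤ β * h x₀ := le_mul_of_one_le_left (hU.trans hpos.le) hβ
  have hαh : h x₀ ≤ α * h x₀ := le_mul_of_one_le_left (hU.trans hpos.le) hα
  -- At an endpoint 4 - x² = -5, and the one-sided sign of h' makes both terms of the first
  -- expression have the same sign.
  rcases eq_or_lt_of_le hx₀.2 with h3 | h3
  · have hd : 0 ≤ deriv h x₀ := by
      have ht : Tendsto (slope h x₀) (𝓝[<] x₀) (𝓝 (deriv h x₀)) :=
        (hasDerivAt_iff_tendsto_slope.1 hdiff).mono_left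
          (nhdsWithin_mono _ fun y hy => ne_of_lt hy)
      refine ge_of_tendsto ht ?_
      have : Ioo (-3 : ℝ) x₀ ∈ 𝓝[<] x₀ := Ioo_mem_nhdsLT (by rw [h3]; norm_num)
      filter_upwards [this] with y hy
      rw [slope_def_field]
      exact div_nonneg_of_nonpos (sub_nonpos.2 (hmax ⟨hy.1.le, hy.2.le.trans hx₀.2⟩))
        (sub_nonpos.2 hy.2.le)
    rw [h3] at u1 hd hpos hαh
    nlinarith [u1.1]
  rcases eq_or_lt_of_le hx₀.1 with h4 | h4
  · have hd : deriv h x₀ ≤ 0 := by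
      have ht : Tendsto (slope h x₀) (𝓝[>] x₀) (𝓝 (deriv h x₀)) :=
        (hasDerivAt_iff_tendsto_slope.1 hdiff).mono_left
          (nhdsWithin_mono _ fun y hy => ne_of_gt hy)
      refine le_of_tendsto ht ?_
      have : Ioo x₀ (3 : ℝ) ∈ 𝓝[>] x₀ := Ioo_mem_nhdsGT (by rw [← h4]; norm_num)
      filter_upwards [this] with y hy
      rw [slope_def_field]
      exact div_nonpos_of_nonpos_of_nonneg
        (sub_nonpos.2 (hmax ⟨hx₀.1.trans hy.1.le, hy.2.le⟩)) (sub_nonneg.2 hy.1.le)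
    rw [← h4] at u1 hd hpos hαh
    nlinarith [u1.2]
  have hloc : IsLocalMax h x₀ := hmax.isLocalMax (Icc_mem_nhds h4 h3)
  have hd0 := hloc.deriv_eq_zero
  rw [hd0, mul_zero, zero_sub] at u1
  -- Here h' = 0. For |x₀| ≥ 2 the term α x₀ h alone exceeds U; otherwise (4 - x₀²)h'' and -βh are
  -- both nonpositive.
  rcases le_or_gt 2 |x₀| with h2 | h2
  · have h5 : |α * x₀ * h x₀| ≤ U := by
      have := hu x₀ hx₀
      rwa [hd0, mul_zero, zero_sub, abs_neg] at this
    rw [abs_mul, abs_mul, abs_of_nonneg (hU.trans hpos.le), abs_of_nonneg (by linarith : 0 ≤ α)]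
      at h5
    have : α * |x₀| ≥ 1 := by nlinarith
    nlinarith
  · have h6 := deriv_deriv_nonpos_of_isLocalMax hh hloc
    have h7 : 0 ≤ 4 - x₀ ^ 2 := by
      have := sq_abs x₀
      nlinarith [abs_nonneg x₀]
    rw [hd0] at v1
    nlinarith [mul_nonneg h7 (neg_nonneg.2 h6), v1.1]

theorem abs_le_of_max_principle {h : ℝ → ℝ} (hh : ContDiff ℝ ∞ h) {α β U : ℝ} (hα : 1 ≤ α)
    (hβ : 1 ≤ β) (hu : ∀ x ∈ Icc (-3 : ℝ) 3, |(4 - x ^ 2) * deriv h x - α * x * h x| ≤ U)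
    (hv : ∀ x ∈ Icc (-3 : ℝ) 3,
      |(4 - x ^ 2) * deriv (deriv h) x - (α + 2) * x * deriv h x - β * h x| ≤ U) :
    ∀ x ∈ Icc (-3 : ℝ) 3, |h x| ≤ U := by
  intro x hx
  refine abs_le'.2 ⟨le_of_max_principle hh hα hβ hu hv x hx, ?_⟩
  have hd : deriv (fun x => -h x) = fun x => -deriv h x := funext fun y => deriv.fun_neg
  refine le_of_max_principle (h := fun x => -h x) hh.neg hα hβ (fun y hy => ?_) (fun y hy => ?_) x hx
  · rw [hd, ← abs_neg]
    convert hu y hy using 2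
    ring
  · rw [hd, deriv.fun_neg, ← abs_neg]
    convert hv y hy using 2
    ring

/-- Inverting L costs one derivative: bounding f^(j) by the maximum principle uses (Lf)^(j) and
(Lf)^(j+1). Induction on the order supplies the lower term j² f^(j-1). -/
theorem exists_bound_of_arcsineOp (N : ℕ) : ∃ C, 0 ≤ C ∧ ∀ (f : ℝ → ℝ) (B : ℝ), ContDiff ℝ ∞ f →
    (∀ j ≤ N + 1, ∀ x ∈ Icc (-3 : ℝ) 3, |iteratedDeriv j (arcsineOp f) x| ≤ B) →
    ∀ j ≤ N, ∀ x ∈ Icc (-3 : ℝ) 3, |iteratedDeriv j f x| ≤ C * B := by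
  have step : ∀ (f : ℝ → ℝ) (B U : ℝ) (j : ℕ), ContDiff ℝ ∞ f → B ≤ U →
      (∀ i ≤ j + 1, ∀ x ∈ Icc (-3 : ℝ) 3, |iteratedDeriv i (arcsineOp f) x| ≤ B) →
      (∀ x ∈ Icc (-3 : ℝ) 3, B + (j : ℝ) ^ 2 * |iteratedDeriv (j - 1) f x| ≤ U) →
      ∀ x ∈ Icc (-3 : ℝ) 3, |iteratedDeriv j f x| ≤ U := by
    intro f B U j hf hBU h1 h2
    have hj0 : (0 : ℝ) ≤ j := j.cast_nonneg
    -- α and β are the coefficients in the formulas for (Lf)^(j) and (Lf)^(j+1). The lower order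
    -- term is moved to the right in the first only.
    refine abs_le_of_max_principle (contDiff_iteratedDeriv hf j) (α := 2 * j + 1)
      (β := ((j : ℝ) + 1) ^ 2) (by linarith) (by nlinarith) (fun x hx => ?_) (fun x hx => ?_)
    · have e := iteratedDeriv_arcsineOp hf j x
      rw [← iteratedDeriv_succ]
      have e' : (4 - x ^ 2) * iteratedDeriv (j + 1) f x - (2 * j + 1) * x * iteratedDeriv j f x
          = iteratedDeriv j (arcsineOp f) x + (j : ℝ) ^ 2 * iteratedDeriv (j - 1) f x := by
        rw [e]; ring
      rw [e']
      refine (abs_add_le _ _).trans ((add_le_add (h1 j j.le_succ x hx) ?_).trans (h2 x hx))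
      rw [abs_mul, abs_of_nonneg (by positivity)]
    · have e := iteratedDeriv_arcsineOp hf (j + 1) x
      rw [← iteratedDeriv_succ, ← iteratedDeriv_succ]
      have e' : (4 - x ^ 2) * iteratedDeriv (j + 1 + 1) f x
          - (2 * j + 1 + 2) * x * iteratedDeriv (j + 1) f x - ((j : ℝ) + 1) ^ 2 * iteratedDeriv j f x
          = iteratedDeriv (j + 1) (arcsineOp f) x := by
        rw [e]; simp only [Nat.add_sub_cancel]; push_cast; ring
      rw [e']
      exact (h1 (j + 1) le_rfl x hx).trans hBU
  induction N with
  | zero =>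
    refine ⟨1, zero_le_one, fun f B hf hB j hj x hx => ?_⟩
    obtain rfl : j = 0 := by omega
    exact step f B (1 * B) 0 hf (by simp) (fun i hi => hB i (by omega)) (fun y hy => by simp) x hx
  | succ N ih =>
    obtain ⟨C, hC0, hC⟩ := ih
    refine ⟨1 + C + ((N + 1 : ℕ) : ℝ) ^ 2 * C, by positivity, fun f B hf hB j hj x hx => ?_⟩
    have hB0 : 0 ≤ B := (abs_nonneg _).trans (hB 0 (Nat.zero_le _) 0 (by norm_num))
    have hN := hC f B hf fun i hi => hB i (by omega)
    have e0 : 0 ≤ C * B := mul_nonneg hC0 hB0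
    have e1 : 0 ≤ ((N + 1 : ℕ) : ℝ) ^ 2 * (C * B) := by positivity
    rcases Nat.lt_or_ge N j with hj' | hj'
    · obtain rfl : j = N + 1 := by omega
      refine step f B _ (N + 1) hf ?_ hB (fun y hy => ?_) x hx
      · nlinarith
      · have := mul_le_mul_of_nonneg_left (hN N le_rfl y hy) (sq_nonneg ((N + 1 : ℕ) : ℝ))
        simp only [Nat.add_sub_cancel]
        nlinarith
    · refine (hN j hj' x hx).trans ?_
      nlinarith

/-! ### Polynomials -/

theorem exists_antiderivative (q : ℝ[X]) (c : ℝ) : ∃ p : ℝ[X], derivative p = q ∧ p.eval 0 = c := by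
  suffices h : ∃ p : ℝ[X], derivative p = q by
    obtain ⟨p, hp⟩ := h
    exact ⟨p + C (c - p.eval 0), by simp [hp], by simp⟩
  induction q using Polynomial.induction_on' with
  | add p q hp hq =>
    obtain ⟨a, rfl⟩ := hp
    obtain ⟨b, rfl⟩ := hq
    exact ⟨a + b, derivative_add⟩
  | monomial n a =>
    refine ⟨monomial (n + 1) (a / (n + 1)), ?_⟩
    rw [derivative_monomial]
    congr 1
    push_cast
    field_simp

/-- Weierstrass applied to the highest derivative, then integration from 0. Since |x| ≤ 3,
integrating an error δ/3 costs at most δ. -/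
theorem exists_polynomial_approx (N : ℕ) {g : ℝ → ℝ} (hg : ContDiff ℝ ∞ g) {δ : ℝ} (hδ : 0 < δ) :
    ∃ p : ℝ[X], ∀ j ≤ N, ∀ x ∈ Icc (-3 : ℝ) 3,
      |iteratedDeriv j (fun x => g x - p.eval x) x| ≤ δ := by
  induction N generalizing g δ with
  | zero =>
    obtain ⟨p, hp⟩ := exists_polynomial_near_of_continuousOn (-3) 3 g hg.continuous.continuousOn δ hδ
    refine ⟨p, fun j hj x hx => ?_⟩
    obtain rfl : j = 0 := by omega
    rw [iteratedDeriv_zero, abs_sub_comm]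
    exact (hp x hx).le
  | succ N ih =>
    obtain ⟨q, hq⟩ := ih (contDiff_infty_iff_deriv.1 hg).2 (δ := δ / 3) (by positivity)
    obtain ⟨p, hp, hp0⟩ := exists_antiderivative q (g 0)
    have hd : ∀ x, HasDerivAt (fun x => g x - p.eval x) (deriv g x - q.eval x) x := by
      intro x
      have := ((contDiff_infty_iff_deriv.1 hg).1 x).hasDerivAt.sub (p.hasDerivAt x)
      rwa [hp] at this
    refine ⟨p, fun j hj x hx => ?_⟩
    rcases j with _ | j
    · have h := (convex_Icc (-3 : ℝ) 3).norm_image_sub_le_of_norm_hasDerivWithin_le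
        (f := fun x => g x - p.eval x) (C := δ / 3) (x := 0) (y := x)
        (fun y _ => (hd y).hasDerivWithinAt)
        (fun y hy => by simpa using hq 0 (Nat.zero_le _) y hy) (by norm_num) hx
      simp only [hp0, sub_self, sub_zero, Real.norm_eq_abs] at h
      rw [iteratedDeriv_zero]
      have : |x| ≤ 3 := abs_le.2 hx
      nlinarith
    · rw [iteratedDeriv_succ', funext fun x => (hd x).deriv]
      exact (hq j (by omega) x hx).trans (by linarith)

theorem arcsineOp_eval (q : ℝ[X]) (x : ℝ) :
    arcsineOp (fun x => q.eval x) x = ((C 4 - X ^ 2) * derivative q - X * q).eval x := by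
  simp [arcsineOp]

/-- L(x^(m+1)) = 4(m+1)x^m - (m+2)x^(m+2), so the degree drops by 2 until 1, or x = L(-1), is
reached. -/
theorem exists_eq_const_add_arcsineOp (p : ℝ[X]) :
    ∃ (c : ℝ) (q : ℝ[X]), ∀ x, p.eval x = c + arcsineOp (fun x => q.eval x) x := by
  suffices h : ∃ (c : ℝ) (q : ℝ[X]), p = C c + ((C 4 - X ^ 2) * derivative q - X * q) by
    obtain ⟨c, q, h⟩ := h
    exact ⟨c, q, fun x => by rw [arcsineOp_eval, ← eval_C (a := c) (x := x), ← eval_add, ← h]⟩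
  induction p using Polynomial.induction_on' with
  | add p q hp hq =>
    obtain ⟨c, a, ha⟩ := hp
    obtain ⟨d, b, hb⟩ := hq
    refine ⟨c + d, a + b, ?_⟩
    rw [derivative_add, map_add]
    linear_combination ha + hb
  | monomial n a =>
    suffices h : ∃ (c : ℝ) (q : ℝ[X]), (X : ℝ[X]) ^ n
        = C c + ((C 4 - X ^ 2) * derivative q - X * q) by
      obtain ⟨c, q, h⟩ := h
      refine ⟨a * c, C a * q, ?_⟩
      rw [← C_mul_X_pow_eq_monomial, h, derivative_C_mul, map_mul]
      ring
    induction n using Nat.strong_induction_on with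
    | _ n ih =>
      match n with
      | 0 => exact ⟨1, 0, by simp⟩
      | 1 => exact ⟨0, -1, by simp⟩
      | m + 2 =>
        obtain ⟨c, q, h⟩ := ih m (by omega)
        have e : (C ((m : ℝ) + 2) : ℝ[X]) * C (((m : ℝ) + 2)⁻¹) = 1 := by
          rw [← map_mul, mul_inv_cancel₀ (by positivity), map_one]
        refine ⟨4 * ((m : ℝ) + 1) * ((m : ℝ) + 2)⁻¹ * c,
          C (4 * ((m : ℝ) + 1) * ((m : ℝ) + 2)⁻¹) * q - C (((m : ℝ) + 2)⁻¹) * X ^ (m + 1), ?_⟩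
        rw [derivative_sub, derivative_C_mul, derivative_C_mul, derivative_X_pow]
        simp only [map_mul, map_add, map_natCast, map_one, map_ofNat, Nat.add_sub_cancel,
          Nat.cast_add, Nat.cast_one] at h e ⊢
        linear_combination (-(X : ℝ[X]) ^ (m + 2)) * e
          + 4 * ((m : ℝ[X]) + 1) * C (((m : ℝ) + 2)⁻¹) * h

/-- With x = 2cos t, -Lf(x) is the t-derivative of 2 sin t · f(2cos t), which vanishes at 0 and π.
By Rolle Lf has a zero in [-2,2], where p = c. -/
theorem abs_const_le_of_arcsineOp {f p : ℝ → ℝ} {c B : ℝ} (hf : ContDiff ℝ ∞ f)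
    (h : ∀ x, p x = c + arcsineOp f x) (hB : ∀ x ∈ Icc (-3 : ℝ) 3, |p x| ≤ B) : |c| ≤ B := by
  have hd : ∀ t : ℝ, HasDerivAt (fun t => 2 * Real.sin t * f (2 * Real.cos t))
      (-arcsineOp f (2 * Real.cos t)) t := by
    intro t
    have h1 : HasDerivAt (fun t => f (2 * Real.cos t))
        (deriv f (2 * Real.cos t) * (2 * -Real.sin t)) t :=
      ((contDiff_infty_iff_deriv.1 hf).1 _).hasDerivAt.comp t ((Real.hasDerivAt_cos t).const_mul 2)
    refine (((Real.hasDerivAt_sin t).const_mul 2).mul h1).congr_deriv ?_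
    simp only [arcsineOp]
    linear_combination (-4 * deriv f (2 * Real.cos t)) * Real.sin_sq_add_cos_sq t
  obtain ⟨t, -, ht⟩ := exists_hasDerivAt_eq_zero Real.pi_pos
    (fun t _ => (hd t).continuousAt.continuousWithinAt) (by simp) (fun t _ => hd t)
  have := h (2 * Real.cos t)
  rw [neg_eq_zero.1 ht, add_zero] at this
  rw [← this]
  exact hB _ ⟨by linarith [Real.neg_one_le_cos t], by linarith [Real.cos_le_one t]⟩

end GUEExpansion

namespace GUEExpansion

open MeasureTheory Filter Topology Set Polynomial

/-! ### Decay outside the limiting support -/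

theorem abs_integral_mul_densS_le {n : ℕ} (hn : 1 ≤ n) {f : ℝ → ℝ} {B : ℝ} (hB : ∀ x, |f x| ≤ B) :
    |∫ x, f x * densS n x| ≤ 2 * B := by
  have h := norm_integral_le_of_norm_le (f := fun x => f x * densS n x)
    ((polyIntegrable_densS hn).integrable.const_mul B) (ae_of_all _ fun x => by
      rw [norm_mul, Real.norm_eq_abs, Real.norm_of_nonneg (densS_nonneg n x)]
      exact mul_le_mul_of_nonneg_right (hB x) (densS_nonneg n x))
  rwa [integral_const_mul, integral_densS hn, Real.norm_eq_abs, mul_comm] at h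

theorem abs_integral_mul_densM_le_integral {n : ℕ} {f w : ℝ → ℝ}
    (hw : Integrable (fun x => w x * densS n x)) (h : ∀ x, |f x| ≤ w x) :
    |∫ x, f x * densM n x| ≤ 1 / 2 * ∫ x, w x * densS n x := by
  rw [← integral_const_mul]
  refine norm_integral_le_of_norm_le (f := fun x => f x * densM n x) (hw.const_mul _)
    (ae_of_all _ fun x => ?_)
  rw [norm_mul, Real.norm_eq_abs, Real.norm_eq_abs]
  calc |f x| * |densM n x| ≤ w x * (densS n x / 2) :=
        mul_le_mul (h x) (abs_densM_le n x) (abs_nonneg _) ((abs_nonneg _).trans (h x))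
    _ = _ := by ring

theorem abs_integral_mul_densS_le_integral {n : ℕ} {f w : ℝ → ℝ}
    (hw : Integrable (fun x => w x * densS n x)) (h : ∀ x, |f x| ≤ w x) :
    |∫ x, f x * densS n x| ≤ ∫ x, w x * densS n x := by
  refine norm_integral_le_of_norm_le (f := fun x => f x * densS n x) hw (ae_of_all _ fun x => ?_)
  rw [norm_mul, Real.norm_eq_abs, Real.norm_of_nonneg (densS_nonneg n x)]
  exact mul_le_mul_of_nonneg_right (h x) (densS_nonneg n x)

theorem abs_integral_mul_densM_le {n : ℕ} (hn : 1 ≤ n) {f : ℝ → ℝ} {B : ℝ}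
    (hB : ∀ x, |f x| ≤ B) : |∫ x, f x * densM n x| ≤ B := by
  refine (abs_integral_mul_densM_le_integral
    ((polyIntegrable_densS hn).integrable.const_mul B) hB).trans ?_
  rw [integral_const_mul, integral_densS hn]
  linarith

/-- A smooth odd step function: `0` on `[-9/4, 9/4]` and `±1` outside `[-5/2, 5/2]`. -/
noncomputable def smoothStep (x : ℝ) : ℝ :=
  Real.smoothTransition (4 * x - 9) - Real.smoothTransition (-4 * x - 9)

theorem contDiff_smoothStep : ContDiff ℝ ∞ smoothStep :=
  (Real.smoothTransition.contDiff.comp (by fun_prop)).sub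
    (Real.smoothTransition.contDiff.comp (by fun_prop))

theorem smoothStep_of_le {x : ℝ} (hx : 0 ≤ x) :
    smoothStep x = Real.smoothTransition (4 * x - 9) := by
  rw [smoothStep, Real.smoothTransition.zero_of_nonpos (x := -4 * x - 9) (by linarith), sub_zero]

theorem smoothStep_of_ge {x : ℝ} (hx : x ≤ 0) :
    smoothStep x = -Real.smoothTransition (-4 * x - 9) := by
  rw [smoothStep, Real.smoothTransition.zero_of_nonpos (x := 4 * x - 9) (by linarith), zero_sub]

theorem abs_smoothStep_le (x : ℝ) : |smoothStep x| ≤ 1 := by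
  rcases le_total 0 x with h | h
  · rw [smoothStep_of_le h, abs_of_nonneg (Real.smoothTransition.nonneg _)]
    exact Real.smoothTransition.le_one _
  · rw [smoothStep_of_ge h, abs_neg, abs_of_nonneg (Real.smoothTransition.nonneg _)]
    exact Real.smoothTransition.le_one _

theorem smoothStep_eq_one {x : ℝ} (h : 5 / 2 ≤ x) : smoothStep x = 1 := by
  rw [smoothStep_of_le (by linarith), Real.smoothTransition.one_of_one_le (by linarith)]

theorem smoothStep_eq_neg_one {x : ℝ} (h : x ≤ -(5 / 2)) : smoothStep x = -1 := by
  rw [smoothStep_of_ge (by linarith), Real.smoothTransition.one_of_one_le (by linarith)]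

theorem mul_abs_smoothStep_le (x : ℝ) : 9 / 4 * |smoothStep x| ≤ x * smoothStep x := by
  rcases le_total 0 x with h | h
  · rw [smoothStep_of_le h, abs_of_nonneg (Real.smoothTransition.nonneg _)]
    rcases le_total x (9 / 4) with h' | h'
    · rw [Real.smoothTransition.zero_of_nonpos (by linarith)]
      simp
    · exact mul_le_mul_of_nonneg_right h' (Real.smoothTransition.nonneg _)
  · rw [smoothStep_of_ge h, abs_neg, abs_of_nonneg (Real.smoothTransition.nonneg _)]
    rcases le_total (-(9 / 4)) x with h' | h'
    · rw [Real.smoothTransition.zero_of_nonpos (by linarith)]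
      simp
    · rw [mul_neg, ← neg_mul]
      exact mul_le_mul_of_nonneg_right (by linarith) (Real.smoothTransition.nonneg _)

theorem exists_bound_iteratedDeriv_smoothStep (j : ℕ) :
    ∃ C, 0 ≤ C ∧ ∀ x, |iteratedDeriv (j + 1) smoothStep x| ≤ C := by
  refine exists_bound_of_eq_zero_off_Icc (r := 5 / 2)
    (contDiff_iteratedDeriv contDiff_smoothStep (j + 1)).continuous fun x hx => ?_
  rw [iteratedDeriv_succ']
  refine iteratedDeriv_eq_zero_of_eqOn (s := (Icc (-(5 / 2) : ℝ) (5 / 2))ᶜ)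
    isClosed_Icc.isOpen_compl (fun y hy => ?_) j hx
  have hy' : y < -(5 / 2) ∨ 5 / 2 < y := by
    by_contra hcon
    push Not at hcon
    exact hy hcon
  rcases hy' with h | h
  · have : smoothStep =ᶠ[𝓝 y] fun _ => -1 := by
      filter_upwards [Iio_mem_nhds h] with z hz using smoothStep_eq_neg_one (le_of_lt hz)
    rw [this.deriv_eq, deriv_const]
  · have : smoothStep =ᶠ[𝓝 y] fun _ => 1 := by
      filter_upwards [Ioi_mem_nhds h] with z hz using smoothStep_eq_one (le_of_lt hz)
    rw [this.deriv_eq, deriv_const]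

theorem integrable_abs_smoothStep_pow_mul {n : ℕ} (hn : 1 ≤ n) (m : ℕ) :
    Integrable (fun x => |smoothStep x| ^ m * densS n x) :=
  (polyIntegrable_densS hn).bdd_mul_integrable (contDiff_smoothStep.continuous.abs.pow m) (B := 1)
    fun x => by
      rw [abs_pow, abs_abs]
      exact pow_le_one₀ (abs_nonneg _) (abs_smoothStep_le x)

/-- Test `integral_id_mul_densS_sub` with t^(2p+3), t = `smoothStep`: two derivatives cost two
powers of t and gain a factor `eps n`. The power is odd so that x t^(2p+3) is nonnegative. -/
theorem exists_integral_smoothStep_pow_le (p : ℕ) : ∃ C, 0 ≤ C ∧ ∀ n, 1 ≤ n →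
    ∫ x, |smoothStep x| ^ (2 * p + 1) * densS n x ≤ C * eps n ^ p := by
  induction p with
  | zero =>
    refine ⟨2, by norm_num, fun n hn => ?_⟩
    have := abs_integral_mul_densS_le hn (f := fun x => |smoothStep x| ^ (2 * 0 + 1)) (B := 1)
      (fun x => by simpa using abs_smoothStep_le x)
    simpa using (le_abs_self _).trans this
  | succ p ih =>
    obtain ⟨C, hC0, hC⟩ := ih
    obtain ⟨C₁, h10, h1⟩ := exists_bound_iteratedDeriv_smoothStep 0
    obtain ⟨C₂, h20, h2⟩ := exists_bound_iteratedDeriv_smoothStep 1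
    -- A |t|^(2p+1) dominates the second derivative of t^(2p+3).
    set A : ℝ := (2 * p + 3) * ((2 * p + 2) * C₁ ^ 2 + C₂) with hA
    have hA0 : 0 ≤ A := by positivity
    refine ⟨2 * A * C, by positivity, fun n hn => ?_⟩
    set t := smoothStep with ht
    set t1 := iteratedDeriv 1 smoothStep
    set t2 := iteratedDeriv 2 smoothStep
    have dt : ∀ x, HasDerivAt t (t1 x) x := fun x => by
      have := hasDerivAt_iteratedDeriv contDiff_smoothStep 0 x
      rwa [iteratedDeriv_zero] at this
    have dt1 : ∀ x, HasDerivAt t1 (t2 x) x := hasDerivAt_iteratedDeriv contDiff_smoothStep 1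
    have ct : Continuous t := contDiff_smoothStep.continuous
    have ct1 : Continuous t1 := (contDiff_iteratedDeriv contDiff_smoothStep 1).continuous
    have ct2 : Continuous t2 := (contDiff_iteratedDeriv contDiff_smoothStep 2).continuous
    have hpow : ∀ (x : ℝ) (m : ℕ), |t x| ^ m ≤ 1 := fun x m =>
      pow_le_one₀ (abs_nonneg _) (abs_smoothStep_le x)
    have d1 : ∀ x, HasDerivAt (fun x => t x ^ (2 * p + 3))
        ((2 * p + 3) * t x ^ (2 * p + 2) * t1 x) x := fun x =>
      ((dt x).pow (2 * p + 3)).congr_deriv (by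
        simp only [Nat.add_succ_sub_one]; push_cast; ring)
    have d2 : ∀ x, HasDerivAt (fun x => (2 * p + 3) * t x ^ (2 * p + 2) * t1 x)
        ((2 * p + 3) * ((2 * p + 2) * t x ^ (2 * p + 1) * t1 x ^ 2 + t x ^ (2 * p + 2) * t2 x)) x :=
      fun x => ((((dt x).pow (2 * p + 2)).const_mul (2 * (p : ℝ) + 3)).mul (dt1 x)).congr_deriv
        (by simp only [Nat.add_succ_sub_one, Pi.pow_apply]; push_cast; ring)
    have b2 : ∀ x, |(2 * p + 3) * ((2 * p + 2) * t x ^ (2 * p + 1) * t1 x ^ 2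
        + t x ^ (2 * p + 2) * t2 x)| ≤ A * |t x| ^ (2 * p + 1) := by
      intro x
      rw [abs_mul, abs_of_nonneg (by positivity : (0 : ℝ) ≤ 2 * p + 3), hA, mul_assoc (2 * (p : ℝ) + 3)]
      refine mul_le_mul_of_nonneg_left ((abs_add_le _ _).trans ?_) (by positivity)
      rw [add_mul ((2 * (p : ℝ) + 2) * C₁ ^ 2) C₂]
      refine add_le_add ?_ ?_
      · rw [abs_mul, abs_mul, abs_pow, abs_pow, abs_of_nonneg (by positivity : (0 : ℝ) ≤ 2 * p + 2)]
        have : |t1 x| ^ 2 ≤ C₁ ^ 2 := pow_le_pow_left₀ (abs_nonneg _) (h1 x) 2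
        calc _ ≤ (2 * (p : ℝ) + 2) * |t x| ^ (2 * p + 1) * C₁ ^ 2 :=
              mul_le_mul_of_nonneg_left this (by positivity)
          _ = _ := by ring
      · rw [abs_mul, abs_pow, pow_succ, mul_assoc, mul_comm C₂]
        refine mul_le_mul_of_nonneg_left ?_ (by positivity)
        calc |t x| * |t2 x| ≤ 1 * C₂ := mul_le_mul (abs_smoothStep_le x) (h2 x) (abs_nonneg _)
              zero_le_one
          _ = C₂ := one_mul _
    have key := integral_id_mul_densS_sub hn d1 d2 (by fun_prop) (B := 1)
      (B' := (2 * p + 3) * C₁) (B'' := A) (fun x => by rw [abs_pow]; exact hpow x _)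
      (fun x => by
        rw [abs_mul, abs_mul, abs_pow, abs_of_nonneg (by positivity : (0 : ℝ) ≤ 2 * p + 3)]
        refine mul_le_mul ?_ (h1 x) (abs_nonneg _) (by positivity)
        exact mul_le_of_le_one_right (by positivity) (hpow x _))
      (fun x => (b2 x).trans (mul_le_of_le_one_right hA0 (hpow x _)))
    have i3 := integrable_abs_smoothStep_pow_mul hn (2 * p + 3)
    have i1 := integrable_abs_smoothStep_pow_mul hn (2 * p + 1)
    have e1 : 9 / 4 * ∫ x, |t x| ^ (2 * p + 3) * densS n x
        ≤ ∫ x, t x ^ (2 * p + 3) * (x * densS n x) := by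
      rw [← integral_const_mul]
      refine integral_mono (i3.const_mul _) ((polyIntegrable_densS hn).id_mul.bdd_mul_integrable
        (ct.pow _) (B := 1) fun x => by rw [abs_pow]; exact hpow x _) fun x => ?_
      have h3 := mul_abs_smoothStep_le x
      have h4 : t x ^ (2 * p + 2) = |t x| ^ (2 * p + 2) := (Even.pow_abs ⟨p + 1, by ring⟩ _).symm
      calc 9 / 4 * (|t x| ^ (2 * p + 3) * densS n x)
          = (|t x| ^ (2 * p + 2) * densS n x) * (9 / 4 * |t x|) := by ring
        _ ≤ (|t x| ^ (2 * p + 2) * densS n x) * (x * t x) :=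
            mul_le_mul_of_nonneg_left h3 (mul_nonneg (by positivity) (densS_nonneg n x))
        _ = _ := by rw [← h4]; ring
    have e2 := (le_abs_self _).trans (abs_integral_mul_densM_le_integral (n := n)
      (f := fun x => t x ^ (2 * p + 3)) i3 fun x => (abs_pow _ _).le)
    have i1' : Integrable (fun x => A * |t x| ^ (2 * p + 1) * densS n x) :=
      (i1.const_mul A).congr (ae_of_all _ fun x => by ring)
    have e3 := (le_abs_self _).trans (abs_integral_mul_densM_le_integral (n := n) i1' b2)
    have e4 : ∫ x, A * |t x| ^ (2 * p + 1) * densS n x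
        = A * ∫ x, |t x| ^ (2 * p + 1) * densS n x := by
      rw [← integral_const_mul]
      congr 1
      ext x
      ring
    rw [e4] at e3
    have e5 := mul_le_mul_of_nonneg_left (hC n hn) hA0
    have e6 := mul_le_mul_of_nonneg_left (e3.trans (mul_le_mul_of_nonneg_left e5 (by norm_num)))
      (eps_nonneg n)
    change _ = eps n * _ at key
    -- The left side keeps 9/4 - 4 · 1/2 = 1/4: on the support of t one has |x| ≥ 9/4, while |M| ≤
    -- S/2.
    have e7 : 1 / 4 * ∫ x, |t x| ^ (2 * p + 3) * densS n x
        ≤ eps n * (1 / 2 * (A * (C * eps n ^ p))) := by linarith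
    change ∫ x, |t x| ^ (2 * p + 3) * densS n x ≤ _
    calc _ ≤ 4 * (eps n * (1 / 2 * (A * (C * eps n ^ p)))) := by linarith
      _ = _ := by ring

/-- |t| = 1 wherever w may be nonzero, so |w| ≤ B |t|^(2k+1). -/
theorem exists_tail_bound (k : ℕ) : ∃ C, 0 ≤ C ∧ ∀ n, 1 ≤ n → ∀ (w : ℝ → ℝ) (B : ℝ),
    (∀ x, |w x| ≤ B) → (∀ x, |x| ≤ 5 / 2 → w x = 0) →
    |∫ x, w x * densS n x| ≤ C * B * eps n ^ k ∧ |∫ x, w x * densM n x| ≤ C * B * eps n ^ k := by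
  obtain ⟨C, hC0, hC⟩ := exists_integral_smoothStep_pow_le k
  refine ⟨C, hC0, fun n hn w B hB hw => ?_⟩
  have hB0 : 0 ≤ B := (abs_nonneg _).trans (hB 0)
  have hdom : ∀ x, |w x| ≤ B * |smoothStep x| ^ (2 * k + 1) := by
    intro x
    rcases le_or_gt |x| (5 / 2) with h | h
    · rw [hw x h, abs_zero]
      positivity
    · have : |smoothStep x| = 1 := by
        rcases lt_abs.1 h with h' | h'
        · rw [smoothStep_eq_one h'.le, abs_one]
        · rw [smoothStep_eq_neg_one (by linarith), abs_neg, abs_one]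
      rw [this, one_pow, mul_one]
      exact hB x
  have hi : Integrable (fun x => B * |smoothStep x| ^ (2 * k + 1) * densS n x) :=
    ((integrable_abs_smoothStep_pow_mul hn (2 * k + 1)).const_mul B).congr
      (ae_of_all _ fun x => by ring)
  have hle : ∫ x, B * |smoothStep x| ^ (2 * k + 1) * densS n x ≤ C * B * eps n ^ k := by
    simp_rw [mul_assoc]
    rw [integral_const_mul]
    calc _ ≤ B * (C * eps n ^ k) := mul_le_mul_of_nonneg_left (hC n hn) hB0
      _ = _ := by ring
  have hpos : 0 ≤ C * B * eps n ^ k := by have := eps_nonneg n; positivity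
  refine ⟨(abs_integral_mul_densS_le_integral hi hdom).trans hle,
    (abs_integral_mul_densM_le_integral hi hdom).trans ?_⟩
  linarith

end GUEExpansion

namespace GUEExpansion

open MeasureTheory Filter Topology Set Polynomial

/-! ### Expansion of one-variable integrals -/

/-- Smooth functions whose derivatives of order at most `N` are bounded by `B`. -/
def BddDerivs (N : ℕ) (B : ℝ) (g : ℝ → ℝ) : Prop :=
  ContDiff ℝ ∞ g ∧ ∀ j ≤ N, ∀ x, |iteratedDeriv j g x| ≤ B

theorem BddDerivs.abs_le {N : ℕ} {B : ℝ} {g : ℝ → ℝ} (h : BddDerivs N B g) (x : ℝ) : |g x| ≤ B := by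
  simpa using h.2 0 (Nat.zero_le _) x

theorem BddDerivs.iteratedDeriv {N m : ℕ} {B : ℝ} {g : ℝ → ℝ} (h : BddDerivs (N + m) B g) :
    BddDerivs N B (iteratedDeriv m g) :=
  ⟨contDiff_iteratedDeriv h.1 m, fun j hj x => by
    rw [iteratedDeriv_iteratedDeriv]; exact h.2 _ (by omega) x⟩

/-- Integration against `Φ n` has expansions of order `k` in powers of `n⁻²`, with remainder
controlled by finitely many derivatives of the test function. -/
def HasFunctionalExp (Φ : ℕ → ℝ → ℝ) (k : ℕ) : Prop :=
  ∃ (C : ℝ) (N : ℕ), 0 ≤ C ∧ ∀ (g : ℝ → ℝ) (B : ℝ), BddDerivs N B g →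
    HasExp k (C * B) (fun n => ∫ x, g x * Φ n x)

/-- A smooth cutoff function, equal to `1` on `[-5/2, 5/2]` and supported in `[-3, 3]`. -/
noncomputable def cutoffBump : ContDiffBump (0 : ℝ) := ⟨5 / 2, 3, by norm_num, by norm_num⟩

/-- The cutoff function underlying `cutoffBump`. -/
noncomputable def cutoff (x : ℝ) : ℝ := cutoffBump x

theorem contDiff_cutoff : ContDiff ℝ ∞ cutoff := cutoffBump.contDiff

theorem cutoff_eq_one {x : ℝ} (h : |x| ≤ 5 / 2) : cutoff x = 1 :=
  cutoffBump.one_of_mem_closedBall (by simpa [cutoffBump] using h)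

theorem cutoff_eq_zero {x : ℝ} (h : x ∉ Icc (-3 : ℝ) 3) : cutoff x = 0 := by
  refine cutoffBump.zero_of_le_dist ?_
  rw [Real.dist_0_eq_abs]
  change (3 : ℝ) ≤ |x|
  by_contra hlt
  exact h (abs_le.1 (not_le.1 hlt).le)

theorem cutoff_nonneg (x : ℝ) : 0 ≤ cutoff x := cutoffBump.nonneg

theorem cutoff_le_one (x : ℝ) : cutoff x ≤ 1 := cutoffBump.le_one

theorem abs_one_sub_cutoff_le (x : ℝ) : |1 - cutoff x| ≤ 1 := by
  rw [abs_le]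
  constructor <;> linarith [cutoff_nonneg x, cutoff_le_one x]

theorem hasDerivAt_of_smooth {f : ℝ → ℝ} (hf : ContDiff ℝ ∞ f) (x : ℝ) :
    HasDerivAt f (deriv f x) x := ((contDiff_infty_iff_deriv.1 hf).1 x).hasDerivAt

/-- With G = xf, Lf = 4f' - xG'. Here ∫f'S = ∫G'M, and `integral_id_mul_densS_sub` for G' cancels
4∫G'M, leaving the ε-term. -/
theorem integral_arcsineOp_mul_densS {n : ℕ} (hn : 1 ≤ n) {f : ℝ → ℝ} (hf : ContDiff ℝ ∞ f)
    (hs : ∀ x, x ∉ Icc (-3 : ℝ) 3 → f x = 0) :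
    ∫ x, arcsineOp f x * densS n x
      = -(eps n * ∫ x, iteratedDeriv 3 (fun x => x * f x) x * densM n x) := by
  set G : ℝ → ℝ := fun x => x * f x with hG
  have hGs : ContDiff ℝ ∞ G := contDiff_id.mul hf
  have hG0 : ∀ x, x ∉ Icc (-3 : ℝ) 3 → G x = 0 := fun x hx => by simp [hG, hs x hx]
  have hz : ∀ {u : ℝ → ℝ}, (∀ x, x ∉ Icc (-3 : ℝ) 3 → u x = 0) → ∀ j x, x ∉ Icc (-3 : ℝ) 3 →
      iteratedDeriv j u x = 0 := fun hu j x hx =>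
    iteratedDeriv_eq_zero_of_eqOn (s := (Icc (-3 : ℝ) 3)ᶜ) isClosed_Icc.isOpen_compl hu j hx
  have hbd : ∀ j, ∃ C, ∀ x, |iteratedDeriv j G x| ≤ C := fun j => by
    obtain ⟨C, -, hC⟩ := exists_bound_of_eq_zero_off_Icc
      (contDiff_iteratedDeriv hGs j).continuous (hz hG0 j)
    exact ⟨C, hC⟩
  obtain ⟨B₁, hB₁⟩ := hbd 1
  obtain ⟨B₂, hB₂⟩ := hbd 2
  obtain ⟨B₃, hB₃⟩ := hbd 3
  obtain ⟨A₀, -, hA₀⟩ := exists_bound_of_eq_zero_off_Icc hf.continuous hs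
  obtain ⟨A₁, -, hA₁⟩ := exists_bound_of_eq_zero_off_Icc
    (contDiff_infty_iff_deriv.1 hf).2.continuous (by simpa [iteratedDeriv_one] using hz hs 1)
  have hG1 : ∀ x, iteratedDeriv 1 G x = f x + x * deriv f x := fun x => by
    rw [iteratedDeriv_one]
    exact (((hasDerivAt_id x).mul (hasDerivAt_of_smooth hf x)).congr_deriv (by simp)).deriv
  have r1 := integral_deriv_mul_densS hn (hasDerivAt_of_smooth hf)
    (contDiff_infty_iff_deriv.1 hf).2.continuous hA₀ hA₁
  have r2 := integral_id_mul_densS_sub hn (hasDerivAt_iteratedDeriv hGs 1)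
    (hasDerivAt_iteratedDeriv hGs 2) (contDiff_iteratedDeriv hGs 3).continuous hB₁ hB₂ hB₃
  simp only [← hG1] at r1
  have i1 := ((polyIntegrable_densS hn).bdd_mul_integrable
    (contDiff_infty_iff_deriv.1 hf).2.continuous hA₁).const_mul 4
  have i2 := (polyIntegrable_densS hn).id_mul.bdd_mul_integrable
    (contDiff_iteratedDeriv hGs 1).continuous hB₁
  have e : ∫ x, arcsineOp f x * densS n x
      = 4 * (∫ x, deriv f x * densS n x) - ∫ x, iteratedDeriv 1 G x * (x * densS n x) := by
    rw [← integral_const_mul, ← integral_sub i1 i2]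
    congr 1
    ext x
    rw [hG1, arcsineOp]
    ring
  rw [e, r1]
  change _ = eps n * _ at r2
  linarith

/-! ### Induction on the order of the expansion -/

theorem hasFunctionalExp_densS_zero : HasFunctionalExp densS 0 :=
  ⟨2, 0, by norm_num, fun g B hg => HasExp.of_small fun n hn => by
    simpa using abs_integral_mul_densS_le hn hg.abs_le⟩

theorem hasFunctionalExp_densM_zero : HasFunctionalExp densM 0 :=
  ⟨1, 0, by norm_num, fun g B hg => HasExp.of_small fun n hn => by
    simpa using abs_integral_mul_densM_le hn hg.abs_le⟩

theorem arcsineOp_cutoff_mul {q : ℝ → ℝ} (hq : ContDiff ℝ ∞ q) (x : ℝ) :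
    arcsineOp (fun x => cutoff x * q x) x
      = cutoff x * arcsineOp q x + (4 - x ^ 2) * deriv cutoff x * q x := by
  have h : deriv (fun x => cutoff x * q x) x = deriv cutoff x * q x + cutoff x * deriv q x :=
    ((hasDerivAt_of_smooth contDiff_cutoff x).mul (hasDerivAt_of_smooth hq x)).deriv
  rw [arcsineOp, h, arcsineOp]
  ring

theorem deriv_cutoff_eq_zero_of_abs_le {x : ℝ} (h : |x| ≤ 5 / 2) : deriv cutoff x = 0 := by
  have hmax : IsLocalMax cutoff x := by
    refine Eventually.of_forall fun y => ?_
    rw [cutoff_eq_one h]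
    exact cutoff_le_one y
  exact hmax.deriv_eq_zero

theorem deriv_cutoff_eq_zero {x : ℝ} (h : x ∉ Icc (-3 : ℝ) 3) : deriv cutoff x = 0 := by
  have := iteratedDeriv_eq_zero_of_eqOn (s := (Icc (-3 : ℝ) 3)ᶜ) isClosed_Icc.isOpen_compl
    (fun x hx => cutoff_eq_zero hx) 1 h
  rwa [iteratedDeriv_one] at this

theorem exists_polynomial_decomposition (N : ℕ) : ∃ C, 0 ≤ C ∧ ∀ (g : ℝ → ℝ) (B δ : ℝ), 0 < δ →
    BddDerivs (N + 1) B g → ∃ (c : ℝ) (p q : ℝ[X]),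
      (∀ x, p.eval x = c + arcsineOp (fun x => q.eval x) x) ∧
      (∀ x ∈ Icc (-3 : ℝ) 3, |g x - p.eval x| ≤ δ) ∧ |c| ≤ B + δ ∧
      ∀ j ≤ N, ∀ x ∈ Icc (-3 : ℝ) 3, |iteratedDeriv j (fun x => q.eval x) x| ≤ C * (B + δ) := by
  obtain ⟨C, hC0, hC⟩ := exists_bound_of_arcsineOp N
  -- The 2 comes from Lq = p - c, where p and c are each bounded by B + δ.
  refine ⟨2 * C, by positivity, fun g B δ hδ hg => ?_⟩
  obtain ⟨p, hp⟩ := exists_polynomial_approx (N + 1) hg.1 hδ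
  obtain ⟨c, q, hq⟩ := exists_eq_const_add_arcsineOp p
  have hps := contDiff_polynomial_eval p
  have hqs := contDiff_polynomial_eval q
  have hpb : ∀ j ≤ N + 1, ∀ x ∈ Icc (-3 : ℝ) 3, |iteratedDeriv j (fun x => p.eval x) x| ≤ B + δ := by
    intro j hj x hx
    have h1 := hp j hj x hx
    have h2 := hg.2 j hj x
    have h3 : iteratedDeriv j (fun x => g x - p.eval x) x
        = iteratedDeriv j g x - iteratedDeriv j (fun x => p.eval x) x :=
      iteratedDeriv_sub (hg.1.contDiffAt.of_le (by exact_mod_cast le_top))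
        (hps.contDiffAt.of_le (by exact_mod_cast le_top))
    rw [h3] at h1
    have h4 : iteratedDeriv j (fun x => p.eval x) x = iteratedDeriv j g x
        - (iteratedDeriv j g x - iteratedDeriv j (fun x => p.eval x) x) := by ring
    rw [h4]
    exact (abs_sub _ _).trans (add_le_add h2 h1)
  have hc : |c| ≤ B + δ := abs_const_le_of_arcsineOp hqs hq fun x hx => by
    simpa using hpb 0 (Nat.zero_le _) x hx
  have hBδ : 0 ≤ B + δ := (abs_nonneg c).trans hc
  refine ⟨c, p, q, hq, fun x hx => by simpa using hp 0 (Nat.zero_le _) x hx, hc, ?_⟩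
  have := hC _ (2 * (B + δ)) hqs fun j hj x hx => ?_
  · intro j hj x hx
    exact (this j hj x hx).trans (le_of_eq (by ring))
  · have hL : arcsineOp (fun x => q.eval x) = fun x => p.eval x - c := funext fun x => by
      rw [hq x]; ring
    rw [hL]
    rcases j with _ | j
    · have h5 : |p.eval x| ≤ B + δ := by simpa using hpb 0 (Nat.zero_le _) x hx
      rw [iteratedDeriv_zero]
      exact (abs_sub _ _).trans (by linarith)
    · have h6 : deriv (fun x => p.eval x - c) = deriv fun x => p.eval x := by
        ext y
        exact deriv_sub_const c
      rw [iteratedDeriv_succ', h6, ← iteratedDeriv_succ']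
      exact (hpb (j + 1) hj x hx).trans (by linarith)

theorem abs_cutoff_mul_le {u : ℝ → ℝ} {B : ℝ} (hB : 0 ≤ B)
    (h : ∀ x ∈ Icc (-3 : ℝ) 3, |u x| ≤ B) (x : ℝ) : |cutoff x * u x| ≤ B := by
  by_cases hx : x ∈ Icc (-3 : ℝ) 3
  · rw [abs_mul, abs_of_nonneg (cutoff_nonneg x)]
    exact (mul_le_of_le_one_left (abs_nonneg _) (cutoff_le_one x)).trans (h x hx)
  · rwa [cutoff_eq_zero hx, zero_mul, abs_zero]

/-- With χ = `cutoff`, g = χ(g - p) + (1 - χ)g + c - c(1 - χ) + L(χq) - (4 - x²)χ'q. The first term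
is the approximation error, those with 1 - χ or χ' are tails, c integrates to 2c, and L(χq) gains ε.
-/
theorem HasFunctionalExp.densS_succ {k : ℕ} (hM : HasFunctionalExp densM k) :
    HasFunctionalExp densS (k + 1) := by
  obtain ⟨C, N, hC0, hC⟩ := hM
  obtain ⟨T, hT0, hT⟩ := exists_tail_bound (k + 1)
  obtain ⟨C₁, hC10, hC₁⟩ := exists_polynomial_decomposition (N + 3)
  have hη : ContDiff ℝ ∞ (fun x => x * cutoff x) := contDiff_id.mul contDiff_cutoff
  obtain ⟨C₂, hC20, hC₂⟩ := exists_bound_iteratedDeriv_mul hη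
    (fun x hx => by rw [cutoff_eq_zero hx, mul_zero]) (N + 3)
  have cχ' : Continuous (deriv cutoff) := (contDiff_infty_iff_deriv.1 contDiff_cutoff).2.continuous
  obtain ⟨C₃, hC30, hC₃⟩ := exists_bound_of_eq_zero_off_Icc (r := 3)
    (f := fun x => (4 - x ^ 2) * deriv cutoff x) (by fun_prop)
    (fun x hx => by rw [deriv_cutoff_eq_zero hx, mul_zero])
  set K : ℝ := C * (C₂ * C₁) + T * (C₃ * C₁) + 2 * T with hK
  have hK0 : 0 ≤ K := by positivity
  -- Three derivatives for (xχq)''' and one lost in inverting L.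
  refine ⟨K, N + 3 + 1, hK0, fun g B hg => HasExp.of_uniform_approx fun δ' hδ' => ?_⟩
  have hB0 : 0 ≤ B := (abs_nonneg _).trans (hg.abs_le 0)
  -- Chosen so that Kδ, the growth of the remainder constant, and 2δ, the approximation error, both
  -- fit into δ'.
  set δ : ℝ := δ' / (K + 2) with hδ
  have hδ0 : 0 < δ := by positivity
  have hδK : (K + 2) * δ = δ' := by rw [hδ]; field_simp
  obtain ⟨c, p, q, hpq, hgp, hc, hq⟩ := hC₁ g B δ hδ0 hg
  have hqs := contDiff_polynomial_eval q
  set Q : ℝ → ℝ := fun x => q.eval x with hQ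
  have hBδ : 0 ≤ B + δ := by positivity
  have hηq := hC₂ Q _ hqs hq
  have hE := hC (iteratedDeriv 3 fun x => x * cutoff x * Q x) (C₂ * (C₁ * (B + δ)))
    (BddDerivs.iteratedDeriv ⟨hη.mul hqs, hηq⟩)
  have hqb : ∀ x ∈ Icc (-3 : ℝ) 3, |Q x| ≤ C₁ * (B + δ) := fun x hx => by
    simpa using hq 0 (Nat.zero_le _) x hx
  have w1 : ∀ x, |(1 - cutoff x) * g x| ≤ B := fun x => by
    rw [abs_mul]
    exact (mul_le_of_le_one_left (abs_nonneg _) (abs_one_sub_cutoff_le x)).trans (hg.abs_le x)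
  have w2 : ∀ x, |(4 - x ^ 2) * deriv cutoff x * Q x| ≤ C₃ * (C₁ * (B + δ)) := by
    intro x
    by_cases hx : x ∈ Icc (-3 : ℝ) 3
    · rw [abs_mul]
      exact mul_le_mul (hC₃ x) (hqb x hx) (abs_nonneg _) hC30
    · rw [deriv_cutoff_eq_zero hx, mul_zero, zero_mul, abs_zero]
      positivity
  have w3 : ∀ x, |cutoff x * (g x - p.eval x)| ≤ δ := abs_cutoff_mul_le hδ0.le hgp
  have cg : Continuous g := hg.1.continuous
  have cχ : Continuous cutoff := contDiff_cutoff.continuous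
  have cp : Continuous fun x => p.eval x := p.continuous
  have cQ : Continuous Q := q.continuous
  have t1 : HasExp (k + 1) (T * B) (fun n => ∫ x, ((1 - cutoff x) * g x) * densS n x) :=
    HasExp.of_small fun n hn => (hT n hn _ B w1 fun x hx => by
      rw [cutoff_eq_one hx, sub_self, zero_mul]).1
  have t2 : HasExp (k + 1) (T * (C₃ * (C₁ * (B + δ))))
      (fun n => ∫ x, ((4 - x ^ 2) * deriv cutoff x * Q x) * densS n x) :=
    HasExp.of_small fun n hn => (hT n hn _ _ w2 fun x hx => by
      rw [deriv_cutoff_eq_zero_of_abs_le hx, mul_zero, zero_mul]).1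
  have t3 : HasExp (k + 1) (T * 1) (fun n => ∫ x, (1 - cutoff x) * densS n x) :=
    HasExp.of_small fun n hn => (hT n hn _ 1 abs_one_sub_cutoff_le fun x hx => by
      rw [cutoff_eq_one hx, sub_self]).1
  refine ⟨_, (((((HasExp.const k (2 * c)).add (t3.const_mul (-c))).add (hE.eps_mul.const_mul (-1))).add
    (t2.const_mul (-1))).add t1).mono ?_, fun n hn => ?_⟩
  · simp only [abs_neg, abs_one, one_mul, mul_one, zero_add]
    have e1 : |c| * T ≤ (B + δ) * T := mul_le_mul_of_nonneg_right hc hT0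
    have e2 : T * B ≤ T * (B + δ) := mul_le_mul_of_nonneg_left (by linarith) hT0
    have e3 : K * B + δ' = K * (B + δ) + 2 * δ := by rw [← hδK]; ring
    rw [e3, hK]
    nlinarith
  · have hS := polyIntegrable_densS hn
    have j1 := hS.bdd_mul_integrable (f := fun x => (1 - cutoff x) * g x) (by fun_prop) w1
    have j2 := hS.bdd_mul_integrable (f := fun x => (4 - x ^ 2) * deriv cutoff x * Q x)
      (by fun_prop) w2
    have j3 := hS.bdd_mul_integrable (f := fun x => 1 - cutoff x) (by fun_prop)
      abs_one_sub_cutoff_le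
    have j4 := hS.bdd_mul_integrable (f := fun x => cutoff x * (g x - p.eval x)) (by fun_prop) w3
    have hχQ : ContDiff ℝ ∞ fun x => cutoff x * Q x := contDiff_cutoff.mul hqs
    have hχQ0 : ∀ x, x ∉ Icc (-3 : ℝ) 3 → cutoff x * Q x = 0 := fun x hx => by
      rw [cutoff_eq_zero hx, zero_mul]
    have cL : Continuous (arcsineOp fun x => cutoff x * Q x) := by
      have := (contDiff_infty_iff_deriv.1 hχQ).2.continuous
      have := hχQ.continuous
      unfold arcsineOp
      fun_prop
    obtain ⟨A, -, hA⟩ := exists_bound_of_eq_zero_off_Icc cL fun x hx => by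
      rw [arcsineOp_cutoff_mul hqs, cutoff_eq_zero hx, deriv_cutoff_eq_zero hx]
      ring
    have j5 := hS.bdd_mul_integrable cL hA
    have ibp := integral_arcsineOp_mul_densS hn hχQ hχQ0
    have hfun : (fun x => x * (cutoff x * Q x)) = fun x => x * cutoff x * Q x := by
      ext x; ring
    rw [hfun] at ibp
    have main : ∫ x, g x * densS n x = (∫ x, cutoff x * (g x - p.eval x) * densS n x)
        + ((c * (∫ x, densS n x) - c * (∫ x, (1 - cutoff x) * densS n x))
        + ((∫ x, arcsineOp (fun x => cutoff x * Q x) x * densS n x)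
        - ∫ x, ((4 - x ^ 2) * deriv cutoff x * Q x) * densS n x))
        + ∫ x, ((1 - cutoff x) * g x) * densS n x := by
      rw [← integral_const_mul, ← integral_const_mul, ← integral_sub (hS.integrable.const_mul c)
        (j3.const_mul c), ← integral_sub j5 j2, ← integral_add, ← integral_add j4, ← integral_add _ j1]
      · congr 1
        ext x
        simp only [arcsineOp_cutoff_mul hqs, hpq x]
        ring
      · exact j4.add (((hS.integrable.const_mul c).sub (j3.const_mul c)).add (j5.sub j2))
      · exact ((hS.integrable.const_mul c).sub (j3.const_mul c)).add (j5.sub j2)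
      · exact (hS.integrable.const_mul c).sub (j3.const_mul c)
      · exact j5.sub j2
    rw [main, ibp, integral_densS hn]
    have small := abs_integral_mul_densS_le hn w3
    have h2δ : 2 * δ ≤ δ' := by
      rw [← hδK]
      exact mul_le_mul_of_nonneg_right (by linarith) hδ0.le
    refine (le_of_eq ?_).trans (small.trans h2δ)
    congr 1
    ring

/-- 4∫χgM = ∫xχgS - ε∫(χg)''M. The cutoff χ is needed because xg may be unbounded. -/
theorem HasFunctionalExp.densM_succ {k : ℕ} (hS : HasFunctionalExp densS (k + 1))
    (hM : HasFunctionalExp densM k) : HasFunctionalExp densM (k + 1) := by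
  obtain ⟨C, N, hC0, hC⟩ := hM
  obtain ⟨C', N', hC'0, hC'⟩ := hS
  obtain ⟨T, hT0, hT⟩ := exists_tail_bound (k + 1)
  have hη : ContDiff ℝ ∞ (fun x => x * cutoff x) := contDiff_id.mul contDiff_cutoff
  obtain ⟨C₁, hC10, hC₁⟩ := exists_bound_iteratedDeriv_mul hη
    (fun x hx => by rw [cutoff_eq_zero hx, mul_zero]) N'
  obtain ⟨C₂, hC20, hC₂⟩ := exists_bound_iteratedDeriv_mul contDiff_cutoff
    (fun x hx => cutoff_eq_zero hx) (N + 2)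
  refine ⟨T + 1 / 4 * (C' * C₁) + 1 / 4 * (C * C₂), max N' (N + 2), by positivity, fun g B hg => ?_⟩
  have b1 := hC₁ g B hg.1 fun j hj x _ => hg.2 j (hj.trans (le_max_left _ _)) x
  have b2 := hC₂ g B hg.1 fun j hj x _ => hg.2 j (hj.trans (le_max_right _ _)) x
  have hχg : ContDiff ℝ ∞ fun x => cutoff x * g x := contDiff_cutoff.mul hg.1
  have t1 := hC' (fun x => x * cutoff x * g x) (C₁ * B) ⟨hη.mul hg.1, b1⟩
  have t2 := hC (iteratedDeriv 2 fun x => cutoff x * g x) (C₂ * B)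
    (BddDerivs.iteratedDeriv ⟨hχg, b2⟩)
  have w1 : ∀ x, |(1 - cutoff x) * g x| ≤ B := fun x => by
    rw [abs_mul]
    exact (mul_le_of_le_one_left (abs_nonneg _) (abs_one_sub_cutoff_le x)).trans (hg.abs_le x)
  have t3 : HasExp (k + 1) (T * B) (fun n => ∫ x, ((1 - cutoff x) * g x) * densM n x) :=
    HasExp.of_small fun n hn => (hT n hn _ B w1 fun x hx => by
      rw [cutoff_eq_one hx, sub_self, zero_mul]).2
  refine HasExp.congr (((t3.add (t1.const_mul (1 / 4))).add (t2.eps_mul.const_mul (-(1 / 4)))).mono ?_)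
    fun n hn => ?_
  · rw [abs_neg, abs_of_pos (by norm_num : (0 : ℝ) < 1 / 4)]
    exact le_of_eq (by ring)
  · have b20 : ∀ x, |cutoff x * g x| ≤ C₂ * B := fun x => by simpa using b2 0 (Nat.zero_le _) x
    have r := integral_id_mul_densS_sub hn (f := fun x => cutoff x * g x)
      (fun x => by
        have := hasDerivAt_iteratedDeriv hχg 0 x
        rwa [iteratedDeriv_zero] at this)
      (hasDerivAt_iteratedDeriv hχg 1) (contDiff_iteratedDeriv hχg 2).continuous
      b20 (b2 1 (by omega)) (b2 2 (by omega))
    change _ = eps n * _ at r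
    have e1 : ∫ x, x * cutoff x * g x * densS n x = ∫ x, cutoff x * g x * (x * densS n x) := by
      congr 1
      ext x
      ring
    have cg : Continuous g := hg.1.continuous
    have cχ : Continuous cutoff := contDiff_cutoff.continuous
    have e2 : ∫ x, g x * densM n x
        = (∫ x, (1 - cutoff x) * g x * densM n x) + ∫ x, cutoff x * g x * densM n x := by
      rw [← integral_add ((polyIntegrable_densM hn).bdd_mul_integrable (by fun_prop) w1)
        ((polyIntegrable_densM hn).bdd_mul_integrable (by fun_prop) b20)]
      congr 1
      ext x
      ring
    rw [e1, e2]
    linarith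

theorem hasFunctionalExp_densM (k : ℕ) : HasFunctionalExp densM k := by
  induction k with
  | zero => exact hasFunctionalExp_densM_zero
  | succ k ih => exact ih.densS_succ.densM_succ ih

theorem hasFunctionalExp_densS (k : ℕ) : HasFunctionalExp densS k := by
  cases k with
  | zero => exact hasFunctionalExp_densS_zero
  | succ k => exact (hasFunctionalExp_densM k).densS_succ

theorem hasFunctionalExp_densD (k : ℕ) : HasFunctionalExp (fun n x => n * densD n x) k := by
  obtain ⟨C, N, hC0, hC⟩ := hasFunctionalExp_densM k
  refine ⟨C, N + 1, hC0, fun g B hg => (hC _ B hg.iteratedDeriv).congr fun n hn => ?_⟩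
  have h := integral_mul_densD hn (fun x => by
    have := hasDerivAt_iteratedDeriv hg.1 0 x
    rwa [iteratedDeriv_zero] at this) (contDiff_iteratedDeriv hg.1 1).continuous hg.abs_le
    (hg.2 1 (by omega))
  rw [← h, ← integral_const_mul]
  congr 1
  ext x
  ring

end GUEExpansion

namespace GUEExpansion

open MeasureTheory Filter Topology Set

/-! ### Expansion of two-variable integrals -/

theorem hasDerivAt_integral_param {Φ : ℝ → ℝ} (hΦ : Integrable Φ) {g g' : ℝ → ℝ → ℝ} {B B' : ℝ}
    (cg : ∀ y, Continuous (g y)) (cg' : ∀ y, Continuous (g' y)) (hB : ∀ y x, |g y x| ≤ B)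
    (hB' : ∀ y x, |g' y x| ≤ B') (hd : ∀ y x, HasDerivAt (fun y => g y x) (g' y x) y) (y : ℝ) :
    HasDerivAt (fun y => ∫ x, g y x * Φ x) (∫ x, g' y x * Φ x) y := by
  refine (hasDerivAt_integral_of_dominated_loc_of_deriv_le (μ := volume) (𝕜 := ℝ) (s := univ)
    (F := fun y x => g y x * Φ x) (F' := fun y x => g' y x * Φ x) (bound := fun x => B' * |Φ x|)
    univ_mem (Eventually.of_forall fun z => ?_) ?_ ?_ (ae_of_all _ fun x z _ => ?_)
    (hΦ.abs.const_mul B') (ae_of_all _ fun x z _ => (hd z x).mul_const _)).2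
  · exact (cg z).aestronglyMeasurable.mul hΦ.aestronglyMeasurable
  · exact hΦ.bdd_mul (cg y).aestronglyMeasurable (c := B) (ae_of_all _ (hB y))
  · exact (cg' y).aestronglyMeasurable.mul hΦ.aestronglyMeasurable
  · rw [norm_mul, Real.norm_eq_abs, Real.norm_eq_abs]
    exact mul_le_mul_of_nonneg_right (hB' z x) (abs_nonneg _)

/-- At n = 1, where ε = 1, coefficient j is F minus the earlier coefficients up to the remainder,
and the constants K do not depend on y. -/
theorem exists_bound_coeff {ι : Type*} {α : ι → ℕ → ℝ} {K : ℕ → ℝ} {F : ι → ℕ → ℝ}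
    (h : ∀ y k, ExpandsWith (α y) k (K k) (F y)) (j : ℕ) : ∃ A, ∀ y, |α y j| ≤ A := by
  induction j using Nat.strong_induction_on with
  | _ j ih =>
    have ih' : ∀ i, ∃ A, i < j → ∀ y, |α y i| ≤ A := fun i => by
      by_cases hi : i < j
      · obtain ⟨A, hA⟩ := ih i hi
        exact ⟨A, fun _ => hA⟩
      · exact ⟨0, fun h => absurd h hi⟩
    choose A hA using ih'
    refine ⟨K 0 + ∑ i ∈ Finset.range j, A i + K (j + 1), fun y => ?_⟩
    have h0 := h y 0 1 le_rfl
    have h1 := h y (j + 1) 1 le_rfl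
    have e : eps 1 = 1 := by simp [eps]
    simp only [Finset.sum_range_succ, e, one_pow, mul_one, Finset.range_zero, Finset.sum_empty,
      sub_zero] at h0 h1
    have h2 : |∑ i ∈ Finset.range j, α y i| ≤ ∑ i ∈ Finset.range j, A i :=
      (Finset.abs_sum_le_sum_abs _ _).trans
        (Finset.sum_le_sum fun i hi => hA i (Finset.mem_range.1 hi) y)
    rw [abs_le] at h0 h1 h2 ⊢
    constructor <;> linarith

/-- Coefficient j is the limit of (F - earlier terms)/ε^j, uniformly in y at every level l. Uniform
convergence of the derivatives allows differentiation of the limit. -/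
theorem hasDerivAt_coeff {α : ℕ → ℝ → ℕ → ℝ} {K : ℕ → ℕ → ℝ} {F : ℕ → ℝ → ℕ → ℝ}
    (h : ∀ l y k, ExpandsWith (α l y) k (K l k) (F l y))
    (hF : ∀ n, 1 ≤ n → ∀ l y, HasDerivAt (fun y => F l y n) (F (l + 1) y n) y) (j l : ℕ) (y : ℝ) :
    HasDerivAt (fun y => α l y j) (α (l + 1) y j) y := by
  induction j using Nat.strong_induction_on generalizing l y with
  | _ j ih =>
    set G : ℕ → ℕ → ℝ → ℝ := fun l n y =>
      (F l y n - ∑ i ∈ Finset.range j, α l y i * eps n ^ i) / eps n ^ j with hG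
    have happ : ∀ l n, 1 ≤ n → ∀ y, |α l y j - G l n y| ≤ K l (j + 1) * eps n := by
      intro l n hn y
      have h1 := h l y (j + 1) n hn
      have hp := pow_pos (eps_pos hn) j
      rw [Finset.sum_range_succ] at h1
      have e : α l y j - G l n y = -(F l y n - (∑ i ∈ Finset.range j, α l y i * eps n ^ i
          + α l y j * eps n ^ j)) / eps n ^ j := by
        simp only [hG]
        field_simp
        ring
      rw [e, abs_div, abs_neg, abs_of_pos hp, div_le_iff₀ hp]
      exact h1.trans (le_of_eq (by ring))
    have hlim : ∀ l, Tendsto (fun n => K l (j + 1) * eps n) atTop (𝓝 0) := fun l => by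
      simpa using tendsto_eps.const_mul (K l (j + 1))
    refine hasDerivAt_of_tendstoUniformly (f := fun n => G l n) (f' := fun n => G (l + 1) n)
      (l := atTop) (g := fun y => α l y j) (g' := fun y => α (l + 1) y j) ?_ ?_ ?_ y
    · rw [Metric.tendstoUniformly_iff]
      intro δ hδ
      filter_upwards [(hlim (l + 1)).eventually (gt_mem_nhds hδ), eventually_ge_atTop 1] with n h1 hn z
      exact (happ (l + 1) n hn z).trans_lt h1
    · filter_upwards [eventually_ge_atTop 1] with n hn z
      exact ((hF n hn l z).sub (HasDerivAt.fun_sum fun i hi =>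
        (ih i (Finset.mem_range.1 hi) l z).mul_const _)).div_const _
    · intro z
      rw [tendsto_iff_dist_tendsto_zero]
      refine squeeze_zero' (Eventually.of_forall fun _ => dist_nonneg) ?_ (hlim l)
      filter_upwards [eventually_ge_atTop 1] with n hn
      rw [dist_comm]
      exact happ l n hn z

theorem bddDerivs_of_hasDerivAt {a : ℕ → ℝ → ℝ} (hd : ∀ l y, HasDerivAt (a l) (a (l + 1) y) y)
    (hb : ∀ l, ∃ A, ∀ y, |a l y| ≤ A) (N : ℕ) : ∃ B, BddDerivs N B (a 0) := by
  have hi : ∀ l, iteratedDeriv l (a 0) = a l := by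
    intro l
    induction l with
    | zero => exact iteratedDeriv_zero
    | succ l ih => rw [iteratedDeriv_succ, ih]; exact funext fun y => (hd l y).deriv
  choose A hA using hb
  refine ⟨∑ l ∈ Finset.range (N + 1), A l, ?_, fun j hj y => ?_⟩
  · refine contDiff_of_differentiable_iteratedDeriv fun m _ => ?_
    rw [hi]
    exact fun y => (hd m y).differentiableAt
  · rw [hi]
    exact (hA j y).trans (Finset.single_le_sum (f := A)
      (fun l _ => (abs_nonneg _).trans (hA l 0)) (Finset.mem_range.2 (by omega)))

/-- The inner integral is expanded to order k + 1, one more than needed, since the L¹ norm of Ψ_n is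
controlled only after multiplication by `eps n`. The slack is for Ψ_n = nD. -/
theorem hasExp_iterated_integral {Φ Ψ : ℕ → ℝ → ℝ} (hΦ : ∀ n, 1 ≤ n → Integrable (Φ n))
    (hΨ : ∀ n, 1 ≤ n → Integrable (Ψ n)) {A : ℝ} (hA : ∀ n, 1 ≤ n → eps n * ∫ y, |Ψ n y| ≤ A)
    (eΦ : ∀ k, HasFunctionalExp Φ k) (eΨ : ∀ k, HasFunctionalExp Ψ k) {g : ℕ → ℝ → ℝ → ℝ}
    (hg : ∀ l N, ∃ B, ∀ y, BddDerivs N B (g l y))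
    (hd : ∀ l y x, HasDerivAt (fun y => g l y x) (g (l + 1) y x) y) (k : ℕ) :
    ∃ K, HasExp k K (fun n => ∫ y, (∫ x, g 0 y x * Φ n x) * Ψ n y) := by
  choose C N hC0 hC using eΦ
  choose B hB using hg
  have hexp : ∀ l y, ∃ a, ∀ k, ExpandsWith a k (C k * B l (N k)) (fun n => ∫ x, g l y x * Φ n x) :=
    fun l y => exists_expandsWith_of_forall_hasExp fun k => hC k _ _ (hB l (N k) y)
  choose α hα using hexp
  have hF : ∀ n, 1 ≤ n → ∀ l y, HasDerivAt (fun y => ∫ x, g l y x * Φ n x)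
      (∫ x, g (l + 1) y x * Φ n x) y := fun n hn l y =>
    hasDerivAt_integral_param (hΦ n hn) (fun y => (hB l 0 y).1.continuous)
      (fun y => (hB (l + 1) 0 y).1.continuous) (fun y => (hB l 0 y).abs_le)
      (fun y => (hB (l + 1) 0 y).abs_le) (hd l) y
  have hαd : ∀ j l y, HasDerivAt (fun y => α l y j) (α (l + 1) y j) y :=
    hasDerivAt_coeff (F := fun l y n => ∫ x, g l y x * Φ n x) hα hF
  have hαb : ∀ j N, ∃ B, BddDerivs N B (fun y => α 0 y j) := fun j =>
    bddDerivs_of_hasDerivAt (a := fun l y => α l y j) (hαd j)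
      fun l => exists_bound_coeff (α := α l) (hα l) j
  have hsum : ∃ K, HasExp k K (fun n => ∑ j ∈ Finset.range (k + 1),
      eps n ^ j * ∫ y, α 0 y j * Ψ n y) := by
    refine HasExp.sum _ fun j _ => ?_
    obtain ⟨C', N', -, hC'⟩ := eΨ k
    obtain ⟨B', hB'⟩ := hαb j N'
    exact (hC' _ _ hB').eps_pow_mul j
  obtain ⟨K, hK⟩ := hsum
  set L := C (k + 1) * B 0 (N (k + 1)) with hL
  have hL0 : 0 ≤ L := mul_nonneg (hC0 _) ((abs_nonneg _).trans ((hB 0 (N (k + 1)) 0).abs_le 0))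
  have hrem : HasExp k (L * A) (fun n => ∫ y, ((∫ x, g 0 y x * Φ n x)
      - ∑ j ∈ Finset.range (k + 1), α 0 y j * eps n ^ j) * Ψ n y) := by
    refine HasExp.of_small fun n hn => ?_
    have h1 := norm_integral_le_of_norm_le (f := fun y => ((∫ x, g 0 y x * Φ n x)
      - ∑ j ∈ Finset.range (k + 1), α 0 y j * eps n ^ j) * Ψ n y)
      ((hΨ n hn).abs.const_mul (L * eps n ^ (k + 1))) (ae_of_all _ fun y => by
        rw [norm_mul, Real.norm_eq_abs, Real.norm_eq_abs]
        exact mul_le_mul_of_nonneg_right (hα 0 y (k + 1) n hn) (abs_nonneg _))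
    rw [integral_const_mul, Real.norm_eq_abs] at h1
    refine h1.trans ?_
    calc _ = (L * eps n ^ k) * (eps n * ∫ y, |Ψ n y|) := by ring
      _ ≤ (L * eps n ^ k) * A :=
          mul_le_mul_of_nonneg_left (hA n hn) (mul_nonneg hL0 (pow_nonneg (eps_nonneg n) k))
      _ = _ := by ring
  refine ⟨_, (hK.add hrem).congr fun n hn => ?_⟩
  have i1 : ∀ j, Integrable (fun y => α 0 y j * Ψ n y) := fun j => by
    obtain ⟨B', hB'⟩ := hαb j 0
    exact (hΨ n hn).bdd_mul hB'.1.continuous.aestronglyMeasurable (c := B') (ae_of_all _ hB'.abs_le)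
  have i2 : Integrable (fun y => (∫ x, g 0 y x * Φ n x) * Ψ n y) := by
    have cF : Continuous fun y => ∫ x, g 0 y x * Φ n x :=
      continuous_iff_continuousAt.2 fun y => (hF n hn 0 y).continuousAt
    refine (hΨ n hn).bdd_mul cF.aestronglyMeasurable (c := C 0 * B 0 (N 0)) (ae_of_all _ fun y => ?_)
    simpa using hα 0 y 0 n hn
  have i3 : ∀ j ∈ Finset.range (k + 1), Integrable (fun y => eps n ^ j * (α 0 y j * Ψ n y)) :=
    fun j _ => (i1 j).const_mul _
  have e1 : ∑ j ∈ Finset.range (k + 1), eps n ^ j * ∫ y, α 0 y j * Ψ n y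
      = ∫ y, ∑ j ∈ Finset.range (k + 1), eps n ^ j * (α 0 y j * Ψ n y) := by
    rw [integral_finsetSum _ i3]
    exact Finset.sum_congr rfl fun j _ => (integral_const_mul _ _).symm
  have e2 : ∀ y, ((∫ x, g 0 y x * Φ n x) - ∑ j ∈ Finset.range (k + 1), α 0 y j * eps n ^ j) * Ψ n y
      = (∫ x, g 0 y x * Φ n x) * Ψ n y
        - ∑ j ∈ Finset.range (k + 1), eps n ^ j * (α 0 y j * Ψ n y) := by
    intro y
    rw [sub_mul, Finset.sum_mul]
    congr 1
    exact Finset.sum_congr rfl fun j _ => by ring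
  simp_rw [e2]
  rw [e1, integral_sub i2 (integrable_finsetSum _ i3)]
  ring

/-! ### Partial derivatives -/

theorem hasDerivAt_fst {f : ℝ × ℝ → ℂ} (hf : ContDiff ℝ ∞ f) (p : ℝ × ℝ) :
    HasDerivAt (fun s : ℝ => f (s, p.2)) (D₁ f p) p.1 := by
  have h : Differentiable ℝ fun s : ℝ => f (s, p.2) :=
    (hf.differentiable (by simp)).comp (by fun_prop)
  exact (h p.1).hasDerivAt

theorem hasDerivAt_snd {f : ℝ × ℝ → ℂ} (hf : ContDiff ℝ ∞ f) (p : ℝ × ℝ) :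
    HasDerivAt (fun t : ℝ => f (p.1, t)) (D₂ f p) p.2 := by
  have h : Differentiable ℝ fun t : ℝ => f (p.1, t) :=
    (hf.differentiable (by simp)).comp (by fun_prop)
  exact (h p.2).hasDerivAt

theorem contDiff_D₁ {f : ℝ × ℝ → ℂ} (hf : ContDiff ℝ ∞ f) : ContDiff ℝ ∞ (D₁ f) := by
  have e : D₁ f = fun p => fderiv ℝ f p ((1 : ℝ), (0 : ℝ)) := by
    ext p
    have h1 : HasDerivAt (fun s : ℝ => (s, p.2)) ((1 : ℝ), (0 : ℝ)) p.1 :=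
      (hasDerivAt_id _).prodMk (hasDerivAt_const _ _)
    exact (((hf.differentiable (by simp)) p).hasFDerivAt.comp_hasDerivAt p.1 h1).deriv
  rw [e]
  exact (hf.fderiv_right (m := ∞) (by simp)).clm_apply contDiff_const

theorem contDiff_D₂ {f : ℝ × ℝ → ℂ} (hf : ContDiff ℝ ∞ f) : ContDiff ℝ ∞ (D₂ f) := by
  have e : D₂ f = fun p => fderiv ℝ f p ((0 : ℝ), (1 : ℝ)) := by
    ext p
    have h1 : HasDerivAt (fun t : ℝ => (p.1, t)) ((0 : ℝ), (1 : ℝ)) p.2 :=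
      (hasDerivAt_const _ _).prodMk (hasDerivAt_id _)
    exact (((hf.differentiable (by simp)) p).hasFDerivAt.comp_hasDerivAt p.2 h1).deriv
  rw [e]
  exact (hf.fderiv_right (m := ∞) (by simp)).clm_apply contDiff_const

theorem contDiff_iterate_D₁ {f : ℝ × ℝ → ℂ} (hf : ContDiff ℝ ∞ f) (a : ℕ) :
    ContDiff ℝ ∞ (D₁^[a] f) := by
  induction a with
  | zero => exact hf
  | succ a ih => rw [Function.iterate_succ_apply']; exact contDiff_D₁ ih

theorem contDiff_iterate_D₂ {f : ℝ × ℝ → ℂ} (hf : ContDiff ℝ ∞ f) (a : ℕ) :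
    ContDiff ℝ ∞ (D₂^[a] f) := by
  induction a with
  | zero => exact hf
  | succ a ih => rw [Function.iterate_succ_apply']; exact contDiff_D₂ ih

/-- L will be the real or the imaginary part, which reduces complex test functions to real ones. -/
theorem iteratedDeriv_comp_slice (L : ℂ →L[ℝ] ℝ) {f : ℝ × ℝ → ℂ} (hf : ContDiff ℝ ∞ f) (y : ℝ)
    (a : ℕ) : iteratedDeriv a (fun x => L (f (x, y))) = fun x => L ((D₁^[a] f) (x, y)) := by
  induction a with
  | zero => exact iteratedDeriv_zero
  | succ a ih =>
    rw [iteratedDeriv_succ, ih]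
    ext x
    rw [Function.iterate_succ_apply']
    exact (L.hasFDerivAt.comp_hasDerivAt x
      (hasDerivAt_fst (contDiff_iterate_D₁ hf a) (x, y))).deriv

section

variable {f : ℝ × ℝ → ℂ}

theorem IsCbInfty.exists_bddDerivs_slice (hf : IsCbInfty f) (L : ℂ →L[ℝ] ℝ) (l N : ℕ) :
    ∃ B, ∀ y, BddDerivs N B (fun x => L ((D₂^[l] f) (x, y))) := by
  choose C hC using fun k => hf.bounded k l
  have h2 := contDiff_iterate_D₂ hf.smooth l
  have hC0 : ∀ k, 0 ≤ C k := fun k => (norm_nonneg _).trans (hC k (0, 0))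
  refine ⟨∑ k ∈ Finset.range (N + 1), ‖L‖ * C k, fun y => ⟨?_, fun j hj x => ?_⟩⟩
  · exact L.contDiff.comp (h2.comp (by fun_prop))
  · rw [iteratedDeriv_comp_slice L h2]
    refine ((L.le_opNorm _).trans (mul_le_mul_of_nonneg_left (hC j _) (norm_nonneg _))).trans ?_
    exact Finset.single_le_sum (f := fun k => ‖L‖ * C k)
      (fun k _ => mul_nonneg (norm_nonneg _) (hC0 k)) (Finset.mem_range.2 (by omega))

theorem IsCbInfty.hasDerivAt_slice (hf : IsCbInfty f) (L : ℂ →L[ℝ] ℝ) (l : ℕ) (y x : ℝ) :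
    HasDerivAt (fun y => L ((D₂^[l] f) (x, y))) (L ((D₂^[l + 1] f) (x, y))) y := by
  rw [Function.iterate_succ_apply']
  exact L.hasFDerivAt.comp_hasDerivAt y (hasDerivAt_snd (contDiff_iterate_D₂ hf.smooth l) (x, y))

theorem IsCbInfty.integrable_mul (hf : IsCbInfty f) (L : ℂ →L[ℝ] ℝ) {u : ℝ × ℝ → ℝ}
    (hu : Integrable u) : Integrable (fun p => L (f p) * u p) := by
  obtain ⟨C, hC⟩ := hf.bounded 0 0
  exact hu.bdd_mul (L.continuous.comp hf.smooth.continuous).aestronglyMeasurable (c := ‖L‖ * C)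
    (ae_of_all _ fun p => (L.le_opNorm _).trans (mul_le_mul_of_nonneg_left (hC p) (norm_nonneg _)))

theorem IsCbInfty.hasExp_integral_prod (hf : IsCbInfty f) (L : ℂ →L[ℝ] ℝ) {Φ : ℕ → ℝ → ℝ}
    (hΦ : ∀ n, 1 ≤ n → Integrable (Φ n)) {A : ℝ} (hA : ∀ n, 1 ≤ n → eps n * ∫ y, |Φ n y| ≤ A)
    (eΦ : ∀ k, HasFunctionalExp Φ k) (k : ℕ) :
    ∃ K, HasExp k K (fun n => ∫ p : ℝ × ℝ, L (f p) * (Φ n p.1 * Φ n p.2)) := by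
  obtain ⟨K, hK⟩ := hasExp_iterated_integral hΦ hΦ hA eΦ eΦ
    (g := fun l y x => L ((D₂^[l] f) (x, y))) (hf.exists_bddDerivs_slice L) (hf.hasDerivAt_slice L) k
  refine ⟨K, hK.congr fun n hn => ?_⟩
  have hi : Integrable (fun p : ℝ × ℝ => L (f p) * (Φ n p.1 * Φ n p.2)) :=
    hf.integrable_mul L ((hΦ n hn).mul_prod (hΦ n hn))
  rw [Measure.volume_eq_prod] at hi ⊢
  rw [integral_prod_symm _ hi]
  congr 1
  ext y
  rw [← integral_mul_const]
  congr 1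
  ext x
  simp only [Function.iterate_zero, id_eq]
  ring

end

/-! ### The expansion for `ρ_n` -/

theorem integrable_rho {n : ℕ} (hn : 1 ≤ n) : Integrable (fun p : ℝ × ℝ => rho n p.1 p.2) := by
  simp only [rho_eq]
  have hS := (polyIntegrable_densS hn).integrable
  have hM := (polyIntegrable_densM hn).integrable
  have hD := (polyIntegrable_densD hn).integrable
  exact (((hS.mul_prod hS).sub (hD.mul_prod hD)).sub ((hM.mul_prod hM).const_mul 4)).const_mul _

theorem integral_abs_densS {n : ℕ} (hn : 1 ≤ n) : ∫ x, |densS n x| = 2 := by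
  simp_rw [abs_of_nonneg (densS_nonneg n _)]
  exact integral_densS hn

theorem IsCbInfty.hasExp_integral_rho {f : ℝ × ℝ → ℂ} (hf : IsCbInfty f) (L : ℂ →L[ℝ] ℝ) (k : ℕ) :
    ∃ K, HasExp k K (fun n => ∫ p : ℝ × ℝ, L (f p) * rho n p.1 p.2) := by
  obtain ⟨K₁, h₁⟩ := hf.hasExp_integral_prod L (Φ := densS)
    (fun n hn => (polyIntegrable_densS hn).integrable) (A := 2) (fun n hn => by
      rw [integral_abs_densS hn]
      linarith [eps_le_one n]) hasFunctionalExp_densS k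
  obtain ⟨K₂, h₂⟩ := hf.hasExp_integral_prod L (Φ := densM)
    (fun n hn => (polyIntegrable_densM hn).integrable) (A := 2) (fun n hn => by
      have h : ∫ x, |densM n x| ≤ ∫ x, |densS n x| :=
        integral_mono (polyIntegrable_densM hn).integrable.abs
          (polyIntegrable_densS hn).integrable.abs fun x => (abs_densM_le n x).trans (by
            rw [abs_of_nonneg (densS_nonneg n x)]
            linarith [densS_nonneg n x])
      rw [integral_abs_densS hn] at h
      have h0 : 0 ≤ ∫ x, |densM n x| := integral_nonneg fun x => abs_nonneg _
      nlinarith [eps_le_one n, eps_nonneg n]) hasFunctionalExp_densM k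
  obtain ⟨K₃, h₃⟩ := hf.hasExp_integral_prod L (Φ := fun n x => n * densD n x)
    (fun n hn => (polyIntegrable_densD hn).integrable.const_mul _) (A := 2) (fun n hn => by
      have h : ∫ x, |densD n x| ≤ ∫ x, |densS n x| :=
        integral_mono (polyIntegrable_densD hn).integrable.abs
          (polyIntegrable_densS hn).integrable.abs fun x => (abs_densD_le n x).trans (le_abs_self _)
      rw [integral_abs_densS hn] at h
      simp_rw [abs_mul, Nat.abs_cast]
      rw [integral_const_mul, ← mul_assoc]
      have hn1 : (1 : ℝ) ≤ n := by exact_mod_cast hn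
      have h1 : eps n * n ≤ 1 := by
        rw [eps, inv_mul_le_iff₀ (by positivity)]
        nlinarith
      have h2 : 0 ≤ eps n * n := mul_nonneg (eps_nonneg n) (by linarith)
      have h0 : 0 ≤ ∫ x, |densD n x| := integral_nonneg fun x => abs_nonneg _
      nlinarith) hasFunctionalExp_densD k
  -- The factor ε = n⁻² undoes the two factors n put on D.
  obtain ⟨K₄, h₄⟩ := h₃.eps_mul.pred
  refine ⟨_, (((h₁.const_mul (1 / 4)).add (h₄.const_mul (-(1 / 4)))).add (h₂.const_mul (-1))).congr
    fun n hn => ?_⟩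
  have hS := (polyIntegrable_densS hn).integrable
  have hM := (polyIntegrable_densM hn).integrable
  have hD := (polyIntegrable_densD hn).integrable.const_mul (n : ℝ)
  have iS := hf.integrable_mul L (hS.mul_prod hS)
  have iM := hf.integrable_mul L (hM.mul_prod hM)
  have iD := hf.integrable_mul L (hD.mul_prod hD)
  have hn0 : (n : ℝ) ≠ 0 := by exact_mod_cast (by omega : n ≠ 0)
  have hε : eps n * (n : ℝ) ^ 2 = 1 := inv_mul_cancel₀ (pow_ne_zero 2 hn0)
  rw [← integral_const_mul (eps n), ← integral_const_mul, ← integral_const_mul,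
    ← integral_const_mul, ← integral_add, ← integral_add]
  · congr 1
    ext p
    rw [rho_eq]
    linear_combination (-(1 / 4) * L (f p) * densD n p.1 * densD n p.2) * hε
  · exact (iS.const_mul _).add ((iD.const_mul _).const_mul _)
  · exact iM.const_mul _
  · exact iS.const_mul _
  · exact (iD.const_mul _).const_mul _

end GUEExpansion

theorem mainTheorem6 (f : ℝ × ℝ → ℂ) (hf : GUEExpansion.IsCbInfty f) :
    (∀ n : ℕ, 1 ≤ n → MeasureTheory.Integrable
      (fun p : ℝ × ℝ => f p * (GUEExpansion.rho n p.1 p.2 : ℂ)) MeasureTheory.volume) ∧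
    ∃ β : ℕ → ℂ, ∀ k : ℕ, ∃ C : ℝ, ∀ n : ℕ, 1 ≤ n →
      ‖(∫ p : ℝ × ℝ, f p * (GUEExpansion.rho n p.1 p.2 : ℂ))
          - ∑ j ∈ Finset.range (k + 1), β j / (n : ℂ) ^ (2 * j)‖
        ≤ C / (n : ℝ) ^ (2 * k + 2) := by
  have hint : ∀ n : ℕ, 1 ≤ n → MeasureTheory.Integrable
      (fun p : ℝ × ℝ => f p * (GUEExpansion.rho n p.1 p.2 : ℂ)) MeasureTheory.volume := by
    intro n hn
    obtain ⟨C, hC⟩ := hf.bounded 0 0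
    exact (GUEExpansion.integrable_rho hn).ofReal.bdd_mul
      hf.smooth.continuous.aestronglyMeasurable (c := C) (MeasureTheory.ae_of_all _ hC)
  refine ⟨hint, ?_⟩
  choose K hK using hf.hasExp_integral_rho Complex.reCLM
  choose K' hK' using hf.hasExp_integral_rho Complex.imCLM
  obtain ⟨a, ha⟩ := GUEExpansion.exists_expandsWith_of_forall_hasExp hK
  obtain ⟨b, hb⟩ := GUEExpansion.exists_expandsWith_of_forall_hasExp hK'
  -- The sum over j ≤ k has k + 1 terms, hence order k + 1 and remainder ε^(k+1) = n^(-2k-2).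
  refine ⟨fun j => (a j : ℂ) + (b j : ℂ) * Complex.I, fun k => ⟨K (k + 1) + K' (k + 1),
    fun n hn => ?_⟩⟩
  have hre : (∫ p : ℝ × ℝ, f p * (GUEExpansion.rho n p.1 p.2 : ℂ)).re
      = ∫ p : ℝ × ℝ, Complex.reCLM (f p) * GUEExpansion.rho n p.1 p.2 := by
    refine (Complex.reCLM.integral_comp_comm (hint n hn)).symm.trans ?_
    congr 1
    ext p
    simp
  have him : (∫ p : ℝ × ℝ, f p * (GUEExpansion.rho n p.1 p.2 : ℂ)).im
      = ∫ p : ℝ × ℝ, Complex.imCLM (f p) * GUEExpansion.rho n p.1 p.2 := by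
    refine (Complex.imCLM.integral_comp_comm (hint n hn)).symm.trans ?_
    congr 1
    ext p
    simp
  have hsum : ∑ j ∈ Finset.range (k + 1), ((a j : ℂ) + (b j : ℂ) * Complex.I) / (n : ℂ) ^ (2 * j)
      = ((∑ j ∈ Finset.range (k + 1), a j * GUEExpansion.eps n ^ j : ℝ) : ℂ)
        + ((∑ j ∈ Finset.range (k + 1), b j * GUEExpansion.eps n ^ j : ℝ) : ℂ) * Complex.I := by
    push_cast
    rw [Finset.sum_mul, ← Finset.sum_add_distrib]
    refine Finset.sum_congr rfl fun j _ => ?_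
    rw [GUEExpansion.eps]
    push_cast
    rw [pow_mul, div_eq_mul_inv, inv_pow]
    ring
  have h1 := ha (k + 1) n hn
  have h2 := hb (k + 1) n hn
  beta_reduce at h1 h2 ⊢
  rw [← hre] at h1
  rw [← him] at h2
  rw [hsum]
  refine (Complex.norm_le_abs_re_add_abs_im _).trans ?_
  have e : (K (k + 1) + K' (k + 1)) / (n : ℝ) ^ (2 * k + 2)
      = K (k + 1) * GUEExpansion.eps n ^ (k + 1) + K' (k + 1) * GUEExpansion.eps n ^ (k + 1) := by
    rw [GUEExpansion.eps, inv_pow, ← pow_mul, div_eq_mul_inv, ← add_mul, mul_add, mul_one]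
  rw [e]
  generalize (∑ j ∈ Finset.range (k + 1), a j * GUEExpansion.eps n ^ j) = u at h1 ⊢
  generalize (∑ j ∈ Finset.range (k + 1), b j * GUEExpansion.eps n ^ j) = v at h2 ⊢
  refine add_le_add (le_of_eq_of_le ?_ h1) (le_of_eq_of_le ?_ h2)
  · simp
  · simp
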